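/- Let $p$ be a prime, let $S$ be a commutative nonarchimedean $\mathbb{Q}_p$-Banach algebra (for example a $\mathbb{Q}_p$-affinoid algebra with a Banach algebra norm), and let $\alpha\in S^\times$ with $|\alpha^{-1}|<1$. Let $L$ be a complete nonarchimedean normed field extension of $\mathbb{Q}_p$ (for example a $p$-adic field with discrete valuation), with an isometric automorphism $\varphi_L$ that is the identity on $\mathbb{Q}_p$. Let $S_L=L\widehat{\otimes}_{\mathbb{Q}_p}S$ be the completion of $L\otimes_{\mathbb{Q}_p}S$ for the nonarchimedean projective tensor norm, and let $\varphi$ be the automorphism of $S_L$ that extends $\varphi_L\otimes\mathrm{id}$ continuously. For a nonarchimedean $\mathbb{Q}_p$-Banach algebra $B$ put $v(x)=-\log_p|x|$ (with $v(0)=\infty$). For $r>0$ let $\widetilde{\mathcal{R}}^r_B$ be the space of formal sums $f=\sum_{i\in\mathbb{Q}}a_iu^i$ with $a_i\in B$ such that (i) for every $c>0$ the set $\{i\in\mathbb{Q}: |a_i|\ge c\}$ is well-ordered, and (ii) for every $s\in(0,r]$, $v(a_i)+si\to\infty$ as $i\to\pm\infty$ and $w_s(f):=\inf_{i}\{v(a_i)+si\}>-\infty$.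 It carries the Fréchet topology given by the $w_s$, $0<s\le r$. Put $\widetilde{\mathcal{R}}_B=\bigcup_{r>0}\widetilde{\mathcal{R}}^r_B$. Extend $\varphi$ to formal sums over $S_L$ by $\varphi(\sum_i a_iu^i)=\sum_i\varphi(a_i)u^{pi}$. Regard the completed projective tensor product $\widetilde{\mathcal{R}}^r_L\widehat{\otimes}_{\mathbb{Q}_p}S$ as a subset of $\widetilde{\mathcal{R}}^r_{S_L}$ through the natural map $(\sum_i a_iu^i)\otimes s\mapsto\sum_i(a_i\otimes s)u^i$. Let $r>0$ and $a=\sum_{i\in\mathbb{Q}}a_iu^i\in\widetilde{\mathcal{R}}^r_{S_L}$, and consider the equation $$\varphi(b)-\alpha b=a.\qquad(*)$$ 1. Equation $(*)$ has at most one solution $b\in\widetilde{\mathcal{R}}_{S_L}$. 2. Equation $(*)$ has a solution $b\in\widetilde{\mathcal{R}}_{S_L}$ if and only if $$\sum_{m\in\mathbb{Z}}\alpha^{-(m+1)}\varphi^m(a_{ip^{-m}})=0\quad\text{for all rational } i<0.$$ In this case the unique solution is $$b=-\sum_{i\in\mathbb{Q}}\Bigl(\sum_{m\ge0}\alpha^{-(m+1)}\varphi^m(a_{ip^{-m}})\Bigr)u^i,$$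 it belongs to $\widetilde{\mathcal{R}}^{pr}_{S_L}$, and $w_r(b)\ge w_r(a)-C$ for a real constant $C=C(r,\alpha)$ that depends only on $r$ and $\alpha$ (and on $p$ and the normed algebra $S$), not on $a$, $L$ or $\varphi_L$. 3. If $a\in\widetilde{\mathcal{R}}^r_L\widehat{\otimes}_{\mathbb{Q}_p}S$ and $b\in\widetilde{\mathcal{R}}_{S_L}$ is a solution of $(*)$, then $b\in\widetilde{\mathcal{R}}^r_L\widehat{\otimes}_{\mathbb{Q}_p}S$. -/

import Mathlib

open scoped TensorProduct Topology
open Filter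

namespace RelRobba

noncomputable section

/-! ### The nonarchimedean projective tensor (semi)norm -/

section Proj

variable {R M N : Type*} [CommRing R] [AddCommGroup M] [Module R M] [AddCommGroup N] [Module R N]

/-- `x` is a finite sum of pure tensors `m ⊗ n` with `q m * q' n ≤ c` for each of them. -/
def ProjBound (q : M → ℝ) (q' : N → ℝ) (x : M ⊗[R] N) (c : ℝ) : Prop :=
  0 ≤ c ∧ ∃ l : List (M × N), (l.map fun z => z.1 ⊗ₜ[R] z.2).sum = x ∧
    ∀ z ∈ l, q z.1 * q' z.2 ≤ c

/-- The nonarchimedean projective tensor seminorm `q ⊗ q'`: the infimum, over all representations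
`x = ∑ mₖ ⊗ nₖ` as a finite sum, of `max_k q mₖ * q' nₖ`. -/
def projNorm (q : M → ℝ) (q' : N → ℝ) (x : M ⊗[R] N) : ℝ :=
  sInf {c | ProjBound q q' x c}

variable {q : M → ℝ} {q' : N → ℝ}

theorem ProjBound.mono {x : M ⊗[R] N} {c d : ℝ} (h : ProjBound q q' x c) (hcd : c ≤ d) :
    ProjBound q q' x d := by
  obtain ⟨h0, l, hl, hb⟩ := h
  exact ⟨h0.trans hcd, l, hl, fun z hz => (hb z hz).trans hcd⟩

theorem ProjBound.add {x y : M ⊗[R] N} {c d : ℝ} (hx : ProjBound q q' x c)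
    (hy : ProjBound q q' y d) : ProjBound q q' (x + y) (max c d) := by
  obtain ⟨h0, l, hl, hb⟩ := hx
  obtain ⟨h0', l', hl', hb'⟩ := hy
  refine ⟨h0.trans (le_max_left _ _), l ++ l', by simp [hl, hl'], ?_⟩
  intro z hz
  rcases List.mem_append.1 hz with h | h
  · exact (hb z h).trans (le_max_left _ _)
  · exact (hb' z h).trans (le_max_right _ _)

theorem ProjBound.tmul (m : M) (n : N) {c : ℝ} (h0 : 0 ≤ c) (h : q m * q' n ≤ c) :
    ProjBound q q' (m ⊗ₜ[R] n) c :=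
  ⟨h0, [(m, n)], by simp, by simpa using h⟩

theorem ProjBound.exists (x : M ⊗[R] N) : ∃ c, ProjBound q q' x c := by
  induction x using TensorProduct.induction_on with
  | zero => exact ⟨0, le_rfl, [], by simp, by simp⟩
  | tmul m n => exact ⟨max 0 (q m * q' n), .tmul m n (le_max_left _ _) (le_max_right _ _)⟩
  | add x y hx hy =>
    obtain ⟨c, hc⟩ := hx
    obtain ⟨d, hd⟩ := hy
    exact ⟨_, hc.add hd⟩

theorem projNorm_nonneg (x : M ⊗[R] N) : 0 ≤ projNorm q q' x :=
  Real.sInf_nonneg fun _ h => h.1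

theorem projNorm_le {x : M ⊗[R] N} {c : ℝ} (h : ProjBound q q' x c) : projNorm q q' x ≤ c :=
  csInf_le ⟨0, fun _ h => h.1⟩ h

theorem ProjBound.of_lt {x : M ⊗[R] N} {c : ℝ} (h : projNorm q q' x < c) :
    ProjBound q q' x c := by
  obtain ⟨d, hd, hdc⟩ := exists_lt_of_csInf_lt (ProjBound.exists x) h
  exact ProjBound.mono hd hdc.le

theorem projNorm_zero : projNorm q q' (0 : M ⊗[R] N) = 0 :=
  le_antisymm (projNorm_le ⟨le_rfl, [], by simp, by simp⟩) (projNorm_nonneg _)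

theorem projNorm_add_le (x y : M ⊗[R] N) :
    projNorm q q' (x + y) ≤ max (projNorm q q' x) (projNorm q q' y) := by
  refine le_of_forall_gt_imp_ge_of_dense fun c hc => ?_
  have hx := ProjBound.of_lt ((le_max_left _ _).trans_lt hc)
  have hy := ProjBound.of_lt ((le_max_right _ _).trans_lt hc)
  simpa using projNorm_le (hx.add hy)

end Proj

/-! ### The completed tensor product `S_L = L ⊗̂ S` -/

/-- `L ⊗ S` over `ℚ_p`, as a carrier for the nonarchimedean projective tensor norm. -/
def ProjTensor (p : ℕ) [Fact p.Prime] (L S : Type*) [NormedCommRing L] [NormedAlgebra ℚ_[p] L]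
    [NormedCommRing S] [NormedAlgebra ℚ_[p] S] : Type _ :=
  L ⊗[ℚ_[p]] S

namespace ProjTensor

variable (p : ℕ) [Fact p.Prime] (L S : Type*) [NormedCommRing L] [NormedAlgebra ℚ_[p] L]
    [NormedCommRing S] [NormedAlgebra ℚ_[p] S]

instance instCommRing : CommRing (ProjTensor p L S) := inferInstanceAs (CommRing (L ⊗[ℚ_[p]] S))

instance instAlgebra : Algebra ℚ_[p] (ProjTensor p L S) := inferInstanceAs (Algebra ℚ_[p] (L ⊗[ℚ_[p]] S))

/-- The identity map. -/
def of : L ⊗[ℚ_[p]] S ≃ₐ[ℚ_[p]] ProjTensor p L S := AlgEquiv.refl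

variable {p L S} in
/-- The projective tensor norm on `L ⊗ S`. -/
def nrm (x : ProjTensor p L S) : ℝ :=
  projNorm (R := ℚ_[p]) (M := L) (N := S) norm norm ((of p L S).symm x)

variable {p L S}

theorem bound_smul {x : L ⊗[ℚ_[p]] S} {c : ℝ} (k : ℚ_[p]) (h : ProjBound norm norm x c) :
    ProjBound norm norm (k • x) (‖k‖ * c) := by
  obtain ⟨h0, l, rfl, hb⟩ := h
  refine ⟨by positivity, l.map fun z => (k • z.1, z.2), ?_, ?_⟩
  · rw [List.smul_sum, List.map_map, List.map_map]
    rfl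
  · intro z hz
    obtain ⟨w, hw, rfl⟩ := List.mem_map.1 hz
    calc ‖k • w.1‖ * ‖w.2‖ = ‖k‖ * (‖w.1‖ * ‖w.2‖) := by rw [norm_smul, mul_assoc]
      _ ≤ ‖k‖ * c := by gcongr; exact hb w hw

theorem bound_mul {x y : L ⊗[ℚ_[p]] S} {c d : ℝ} (hx : ProjBound norm norm x c)
    (hy : ProjBound norm norm y d) : ProjBound norm norm (x * y) (c * d) := by
  obtain ⟨h0, l, rfl, hb⟩ := hx
  obtain ⟨h0', l', rfl, hb'⟩ := hy
  refine ⟨by positivity, (l ×ˢ l').map fun z => (z.1.1 * z.2.1, z.1.2 * z.2.2), ?_, ?_⟩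
  · clear hb hb'
    induction l with
    | nil => simp
    | cons u l ih =>
      rw [List.product_cons, List.map_append, List.map_append, List.sum_append, ih, List.map_cons,
        List.sum_cons, add_mul, List.map_map]
      congr 1
      clear ih
      induction l' with
      | nil => simp
      | cons v l' ih' =>
        simp only [List.map_cons, List.sum_cons, mul_add, Algebra.TensorProduct.tmul_mul_tmul,
          Function.comp_apply]
        congr 1
  · intro z hz
    obtain ⟨⟨u, w⟩, huw, rfl⟩ := List.mem_map.1 hz
    obtain ⟨hu, hw⟩ := List.pair_mem_product.1 huw
    calc ‖u.1 * w.1‖ * ‖u.2 * w.2‖ ≤ (‖u.1‖ * ‖w.1‖) * (‖u.2‖ * ‖w.2‖) := by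
          gcongr <;> exact norm_mul_le _ _
      _ = (‖u.1‖ * ‖u.2‖) * (‖w.1‖ * ‖w.2‖) := by ring
      _ ≤ c * d := by
          gcongr
          · exact hb u hu
          · exact hb' w hw

theorem nrm_nonneg (x : ProjTensor p L S) : 0 ≤ nrm x := projNorm_nonneg _

theorem nrm_add_le_max (x y : ProjTensor p L S) : nrm (x + y) ≤ max (nrm x) (nrm y) :=
  projNorm_add_le (R := ℚ_[p]) (M := L) (N := S) x y

theorem nrm_smul_le (k : ℚ_[p]) (x : ProjTensor p L S) : nrm (k • x) ≤ ‖k‖ * nrm x := by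
  have h : ∀ ε > 0, nrm (k • x) ≤ ‖k‖ * (nrm x + ε) := fun ε hε =>
    projNorm_le (bound_smul k (ProjBound.of_lt (lt_add_of_pos_right _ hε)))
  refine ge_of_tendsto (f := fun ε => ‖k‖ * (nrm x + ε)) (x := 𝓝[>] (0 : ℝ)) ?_
    (eventually_mem_nhdsWithin.mono h)
  have : Continuous fun ε : ℝ => ‖k‖ * (nrm x + ε) := by fun_prop
  simpa using (this.tendsto 0).mono_left nhdsWithin_le_nhds

theorem nrm_mul_le (x y : ProjTensor p L S) : nrm (x * y) ≤ nrm x * nrm y := by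
  have h : ∀ ε > 0, nrm (x * y) ≤ (nrm x + ε) * (nrm y + ε) := fun ε hε =>
    projNorm_le (bound_mul (ProjBound.of_lt (lt_add_of_pos_right _ hε))
      (ProjBound.of_lt (lt_add_of_pos_right _ hε)))
  refine ge_of_tendsto (f := fun ε => (nrm x + ε) * (nrm y + ε)) (x := 𝓝[>] (0 : ℝ)) ?_
    (eventually_mem_nhdsWithin.mono h)
  have : Continuous fun ε : ℝ => (nrm x + ε) * (nrm y + ε) := by fun_prop
  simpa using (this.tendsto 0).mono_left nhdsWithin_le_nhds

variable (p L S) in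
/-- The projective tensor norm as a seminorm of additive groups. -/
def groupSeminorm : AddGroupSeminorm (ProjTensor p L S) where
  toFun := nrm
  map_zero' := projNorm_zero
  add_le' x y := (nrm_add_le_max x y).trans (max_le_add_of_nonneg (nrm_nonneg x) (nrm_nonneg y))
  neg' x := by
    have h : ∀ y : ProjTensor p L S, nrm (-y) ≤ nrm y := fun y => by
      simpa using nrm_smul_le (-1 : ℚ_[p]) y
    exact le_antisymm (h x) (by simpa using h (-x))

instance instSeminormedAddCommGroup : SeminormedAddCommGroup (ProjTensor p L S) :=
  (groupSeminorm p L S).toSeminormedAddCommGroup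

theorem norm_def (x : ProjTensor p L S) : ‖x‖ = nrm x := rfl

instance instSeminormedCommRing : SeminormedCommRing (ProjTensor p L S) :=
  { (inferInstance : SeminormedAddCommGroup (ProjTensor p L S)),
    instCommRing p L S with
    norm_mul_le := nrm_mul_le }

instance instNormedAlgebra : NormedAlgebra ℚ_[p] (ProjTensor p L S) :=
  { instAlgebra p L S with
    norm_smul_le := nrm_smul_le }

end ProjTensor

/-- The completed tensor product `S_L = L ⊗̂ S` over `ℚ_p`, a Banach algebra over `ℚ_p`. -/
abbrev CTensor (p : ℕ) [Fact p.Prime] (L S : Type*) [NormedCommRing L] [NormedAlgebra ℚ_[p] L]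
    [NormedCommRing S] [NormedAlgebra ℚ_[p] S] : Type _ :=
  UniformSpace.Completion (ProjTensor p L S)

section CTensor

variable (p : ℕ) [Fact p.Prime] (L S : Type*) [NormedCommRing L] [NormedAlgebra ℚ_[p] L]
    [NormedCommRing S] [NormedAlgebra ℚ_[p] S]

instance : IsUltrametricDist (CTensor p L S) := by
  apply IsUltrametricDist.isUltrametricDist_of_forall_norm_add_le_max_norm
  intro x y
  induction x, y using UniformSpace.Completion.induction_on₂ with
  | hp => exact isClosed_le (by fun_prop) (by fun_prop)
  | ih x y =>
    rw [← UniformSpace.Completion.coe_add, UniformSpace.Completion.norm_coe,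
      UniformSpace.Completion.norm_coe, UniformSpace.Completion.norm_coe]
    exact ProjTensor.nrm_add_le_max x y

/-- The structure map `S → S_L`, `s ↦ 1 ⊗ s`. -/
def inclS : S →+* CTensor p L S :=
  (UniformSpace.Completion.coeRingHom (α := ProjTensor p L S)).comp
    (((ProjTensor.of p L S : L ⊗[ℚ_[p]] S →+* ProjTensor p L S)).comp
      (Algebra.TensorProduct.includeRight : S →ₐ[ℚ_[p]] L ⊗[ℚ_[p]] S).toRingHom)

variable {p L}

/-- `σ ⊗ id` on `L ⊗ S`. -/
def tensorMap (σ : L ≃ₐ[ℚ_[p]] L) : ProjTensor p L S →+* ProjTensor p L S :=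
  (((ProjTensor.of p L S).toAlgHom.comp
    (Algebra.TensorProduct.map (σ : L →ₐ[ℚ_[p]] L) (AlgHom.id ℚ_[p] S))).comp
      (ProjTensor.of p L S).symm.toAlgHom).toRingHom

variable {S} in
theorem norm_tensorMap_le (σ : L ≃ₐ[ℚ_[p]] L) (hσ : ∀ x, ‖σ x‖ = ‖x‖) (x : ProjTensor p L S) :
    ‖tensorMap S σ x‖ ≤ ‖x‖ := by
  refine le_of_forall_gt_imp_ge_of_dense fun c hc => projNorm_le ?_
  obtain ⟨h0, l, hl, hb⟩ := ProjBound.of_lt hc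
  refine ⟨h0, l.map fun z => (σ z.1, z.2), ?_, ?_⟩
  · change _ = Algebra.TensorProduct.map (σ : L →ₐ[ℚ_[p]] L) (AlgHom.id ℚ_[p] S)
      ((ProjTensor.of p L S).symm x)
    rw [← hl, map_list_sum, List.map_map, List.map_map]
    simp [Function.comp_def]
  · intro z hz
    obtain ⟨w, hw, rfl⟩ := List.mem_map.1 hz
    simpa [hσ] using hb w hw

theorem continuous_tensorMap (σ : L ≃ₐ[ℚ_[p]] L) (hσ : ∀ x, ‖σ x‖ = ‖x‖) :
    Continuous (tensorMap S σ) :=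
  AddMonoidHomClass.continuous_of_bound (tensorMap S σ) 1
    (by simpa using norm_tensorMap_le σ hσ)

theorem tensorMap_comp_symm (σ : L ≃ₐ[ℚ_[p]] L) :
    (tensorMap S σ).comp (tensorMap S σ.symm) = RingHom.id _ := by
  ext x
  change Algebra.TensorProduct.map (σ : L →ₐ[ℚ_[p]] L) (AlgHom.id ℚ_[p] S)
    (Algebra.TensorProduct.map (σ.symm : L →ₐ[ℚ_[p]] L) (AlgHom.id ℚ_[p] S)
      ((ProjTensor.of p L S).symm x)) = (ProjTensor.of p L S).symm x
  generalize (ProjTensor.of p L S).symm x = y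
  induction y using TensorProduct.induction_on with
  | zero => simp
  | tmul a b => simp
  | add a b ha hb => simp only [map_add, ha, hb]

/-- The Frobenius `φ` of `S_L`: the continuous extension of `φ_L ⊗ id`, for an isometric
automorphism `φ_L` of `L` over `ℚ_p`. -/
def frob (σ : L ≃ₐ[ℚ_[p]] L) (hσ : ∀ x, ‖σ x‖ = ‖x‖) : CTensor p L S ≃+* CTensor p L S :=
  have hσ' : ∀ x, ‖σ.symm x‖ = ‖x‖ := fun x => by
    simpa using (hσ (σ.symm x)).symm
  have hid : ∀ (f : ProjTensor p L S →+* ProjTensor p L S) (hf : Continuous f),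
      f = RingHom.id _ → UniformSpace.Completion.mapRingHom f hf = RingHom.id _ := by
    rintro _ _ rfl
    exact UniformSpace.Completion.mapRingHom_id
  RingEquiv.ofRingHom
    (UniformSpace.Completion.mapRingHom (tensorMap S σ) (continuous_tensorMap S σ hσ))
    (UniformSpace.Completion.mapRingHom (tensorMap S σ.symm) (continuous_tensorMap S σ.symm hσ'))
    (by
      rw [UniformSpace.Completion.mapRingHom_comp]
      exact hid _ _ (tensorMap_comp_symm S σ))
    (by
      rw [UniformSpace.Completion.mapRingHom_comp]
      exact hid _ _ (tensorMap_comp_symm S σ.symm))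

theorem frob_tmul (σ : L ≃ₐ[ℚ_[p]] L) (hσ : ∀ x, ‖σ x‖ = ‖x‖) (l : L) (s : S) :
    frob S σ hσ ((ProjTensor.of p L S (l ⊗ₜ s) : ProjTensor p L S) : CTensor p L S) =
      ((ProjTensor.of p L S (σ l ⊗ₜ s) : ProjTensor p L S) : CTensor p L S) :=
  UniformSpace.Completion.mapRingHom_coe (f := tensorMap S σ) (continuous_tensorMap S σ hσ) _

/-- `φ` on formal sums: `φ(∑ aᵢ uⁱ) = ∑ φ(aᵢ) u^{p i}`. The formal sum `∑_{i ∈ ℚ} aᵢ uⁱ` is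
represented by its coefficient function `i ↦ aᵢ`. -/
def frobSeries (σ : L ≃ₐ[ℚ_[p]] L) (hσ : ∀ x, ‖σ x‖ = ‖x‖) (f : ℚ → CTensor p L S) :
    ℚ → CTensor p L S :=
  fun i => frob S σ hσ (f (i / p))

end CTensor

/-! ### The extended Robba ring -/

section Robba

variable (p : ℕ) {B : Type*} [NormedAddCommGroup B]

/-- `v(x) = -log_p |x|`, with `v(0) = ∞`. -/
def val (x : B) : EReal :=
  if ‖x‖ = 0 then ⊤ else ((-Real.logb p ‖x‖ : ℝ) : EReal)

/-- `v(aᵢ) + s i`. -/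
def wterm (s : ℝ) (f : ℚ → B) (i : ℚ) : EReal :=
  val p (f i) + ((s * (i : ℝ) : ℝ) : EReal)

/-- `w_s(f) = inf_i (v(aᵢ) + s i)`, with `w_s(0) = ∞`. -/
def w (s : ℝ) (f : ℚ → B) : EReal := ⨅ i : ℚ, wterm p s f i

/-- `|f|_s = sup_i |aᵢ| p^{-s i}` (used for `f` with `w_s(f) > -∞` only). -/
def gaussNorm (s : ℝ) (f : ℚ → B) : ℝ := ⨆ i : ℚ, ‖f i‖ * (p : ℝ) ^ (-(s * (i : ℝ)))

/-- The two conditions that define the extended Robba ring over `B` for an interval `I` of positive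
real numbers. -/
structure IsExtRobba (I : Set ℝ) (f : ℚ → B) : Prop where
  wf : ∀ c : ℝ, 0 < c → {i : ℚ | c ≤ ‖f i‖}.IsWF
  tendsto_atTop : ∀ s ∈ I, Tendsto (wterm p s f) atTop (𝓝 ⊤)
  tendsto_atBot : ∀ s ∈ I, Tendsto (wterm p s f) atBot (𝓝 ⊤)
  bot_lt : ∀ s ∈ I, ⊥ < w p s f

variable {p}

theorem lt_wterm_iff (hp : 1 < p) (s : ℝ) (f : ℚ → B) (i : ℚ) (M : ℝ) :
    (M : EReal) < wterm p s f i ↔ ‖f i‖ * (p : ℝ) ^ (-(s * (i : ℝ))) < (p : ℝ) ^ (-M) := by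
  have hp1 : (1 : ℝ) < p := by exact_mod_cast hp
  have hp0 : (0 : ℝ) < p := by linarith
  unfold wterm val
  split_ifs with h
  · simp only [h, zero_mul, EReal.top_add_coe, EReal.coe_lt_top, true_iff]
    positivity
  · have hpos : 0 < ‖f i‖ := lt_of_le_of_ne (norm_nonneg _) (Ne.symm h)
    rw [← EReal.coe_add, EReal.coe_lt_coe_iff]
    have hx : ‖f i‖ * (p : ℝ) ^ (-(s * (i : ℝ))) =
        (p : ℝ) ^ (Real.logb p ‖f i‖ + -(s * (i : ℝ))) := by
      rw [Real.rpow_add hp0, Real.rpow_logb hp0 hp1.ne' hpos]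
    rw [hx, Real.rpow_lt_rpow_left_iff hp1]
    constructor <;> intro h' <;> linarith

theorem le_wterm_iff (hp : 1 < p) (s : ℝ) (f : ℚ → B) (i : ℚ) (M : ℝ) :
    (M : EReal) ≤ wterm p s f i ↔ ‖f i‖ * (p : ℝ) ^ (-(s * (i : ℝ))) ≤ (p : ℝ) ^ (-M) := by
  have hp1 : (1 : ℝ) < p := by exact_mod_cast hp
  have hp0 : (0 : ℝ) < p := by linarith
  unfold wterm val
  split_ifs with h
  · simp only [h, zero_mul, EReal.top_add_coe, le_top, true_iff]
    positivity
  · have hpos : 0 < ‖f i‖ := lt_of_le_of_ne (norm_nonneg _) (Ne.symm h)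
    rw [← EReal.coe_add, EReal.coe_le_coe_iff]
    have hx : ‖f i‖ * (p : ℝ) ^ (-(s * (i : ℝ))) =
        (p : ℝ) ^ (Real.logb p ‖f i‖ + -(s * (i : ℝ))) := by
      rw [Real.rpow_add hp0, Real.rpow_logb hp0 hp1.ne' hpos]
    rw [hx, Real.rpow_le_rpow_left_iff hp1]
    constructor <;> intro h' <;> linarith

theorem tendsto_wterm_iff (hp : 1 < p) (s : ℝ) (f : ℚ → B) (l : Filter ℚ) :
    Tendsto (wterm p s f) l (𝓝 ⊤) ↔
      Tendsto (fun i : ℚ => ‖f i‖ * (p : ℝ) ^ (-(s * (i : ℝ)))) l (𝓝 0) := by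
  have hp1 : (1 : ℝ) < p := by exact_mod_cast hp
  have hp0 : (0 : ℝ) < p := by linarith
  rw [EReal.tendsto_nhds_top_iff_real, Metric.tendsto_nhds]
  have key : ∀ i : ℚ, dist (‖f i‖ * (p : ℝ) ^ (-(s * (i : ℝ)))) 0 =
      ‖f i‖ * (p : ℝ) ^ (-(s * (i : ℝ))) := fun i => by
    rw [Real.dist_eq, sub_zero, abs_of_nonneg (by positivity)]
  simp only [lt_wterm_iff hp, key]
  constructor
  · intro h ε hε
    refine (h (-Real.logb p ε)).mono fun i hi => ?_
    rwa [neg_neg, Real.rpow_logb hp0 hp1.ne' hε] at hi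
  · intro h M
    exact h _ (by positivity)

theorem bot_lt_w_iff (hp : 1 < p) (s : ℝ) (f : ℚ → B) :
    ⊥ < w p s f ↔ ∃ C : ℝ, ∀ i : ℚ, ‖f i‖ * (p : ℝ) ^ (-(s * (i : ℝ))) ≤ C := by
  have hp1 : (1 : ℝ) < p := by exact_mod_cast hp
  have hp0 : (0 : ℝ) < p := by linarith
  constructor
  · intro h
    obtain ⟨M, -, hM⟩ := EReal.lt_iff_exists_real_btwn.1 h
    exact ⟨(p : ℝ) ^ (-M), fun i => (le_wterm_iff hp s f i M).1 (hM.le.trans (iInf_le _ i))⟩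
  · rintro ⟨C, hC⟩
    have hC' : 0 < max C 1 := lt_max_of_lt_right one_pos
    refine (EReal.bot_lt_coe (-Real.logb p (max C 1))).trans_le (le_iInf fun i => ?_)
    rw [le_wterm_iff hp, neg_neg, Real.rpow_logb hp0 hp1.ne' hC']
    exact (hC i).trans (le_max_left _ _)

/-- The defining conditions in terms of `|aᵢ| p^{-s i}`. -/
theorem isExtRobba_iff (hp : 1 < p) (I : Set ℝ) (f : ℚ → B) :
    IsExtRobba p I f ↔ (∀ c : ℝ, 0 < c → {i : ℚ | c ≤ ‖f i‖}.IsWF) ∧ ∀ s ∈ I,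
      Tendsto (fun i : ℚ => ‖f i‖ * (p : ℝ) ^ (-(s * (i : ℝ)))) atTop (𝓝 0) ∧
      Tendsto (fun i : ℚ => ‖f i‖ * (p : ℝ) ^ (-(s * (i : ℝ)))) atBot (𝓝 0) ∧
      ∃ C : ℝ, ∀ i : ℚ, ‖f i‖ * (p : ℝ) ^ (-(s * (i : ℝ))) ≤ C := by
  constructor
  · rintro ⟨h1, h2, h3, h4⟩
    exact ⟨h1, fun s hs => ⟨(tendsto_wterm_iff hp s f _).1 (h2 s hs),
      (tendsto_wterm_iff hp s f _).1 (h3 s hs), (bot_lt_w_iff hp s f).1 (h4 s hs)⟩⟩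
  · rintro ⟨h1, h2⟩
    exact ⟨h1, fun s hs => (tendsto_wterm_iff hp s f _).2 (h2 s hs).1,
      fun s hs => (tendsto_wterm_iff hp s f _).2 (h2 s hs).2.1,
      fun s hs => (bot_lt_w_iff hp s f).2 (h2 s hs).2.2⟩

variable (p)

/-- The additive group of the extended Robba ring over `B` for the interval `I`, as a
`ℚ_p`-subspace of the space of all formal sums `∑_{i ∈ ℚ} aᵢ uⁱ`. -/
def extRobba [Fact p.Prime] [NormedSpace ℚ_[p] B] [IsUltrametricDist B] (I : Set ℝ) :
    Submodule ℚ_[p] (ℚ → B) where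
  carrier := {f | IsExtRobba p I f}
  zero_mem' := by
    rw [Set.mem_ofPred_eq, isExtRobba_iff (Fact.out : p.Prime).one_lt]
    refine ⟨fun c hc => ?_, fun s _ => ⟨by simp, by simp, 0, by simp⟩⟩
    have : {i : ℚ | c ≤ ‖(0 : ℚ → B) i‖} = ∅ := by
      ext i
      simpa using hc
    rw [this]
    exact Set.isWF_empty
  add_mem' := by
    intro f g hf hg
    have hp1 : 1 < p := (Fact.out : p.Prime).one_lt
    rw [Set.mem_ofPred_eq, isExtRobba_iff hp1] at *
    have hle : ∀ (s : ℝ) (i : ℚ), ‖(f + g) i‖ * (p : ℝ) ^ (-(s * (i : ℝ))) ≤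
        ‖f i‖ * (p : ℝ) ^ (-(s * (i : ℝ))) + ‖g i‖ * (p : ℝ) ^ (-(s * (i : ℝ))) := by
      intro s i
      rw [← add_mul, Pi.add_apply]
      gcongr
      exact norm_add_le _ _
    refine ⟨fun c hc => ((hf.1 c hc).union (hg.1 c hc)).mono fun i hi => ?_, fun s hs => ?_⟩
    · exact le_max_iff.1 (le_trans hi (IsUltrametricDist.norm_add_le_max (f i) (g i)))
    · obtain ⟨h1, h2, C, hC⟩ := hf.2 s hs
      obtain ⟨h1', h2', C', hC'⟩ := hg.2 s hs
      refine ⟨squeeze_zero (fun i => by positivity) (hle s) (by simpa using h1.add h1'),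
        squeeze_zero (fun i => by positivity) (hle s) (by simpa using h2.add h2'),
        C + C', fun i => (hle s i).trans (add_le_add (hC i) (hC' i))⟩
  smul_mem' := by
    intro k f hf
    have hp1 : 1 < p := (Fact.out : p.Prime).one_lt
    rw [Set.mem_ofPred_eq, isExtRobba_iff hp1] at *
    have he : ∀ (s : ℝ) (i : ℚ), ‖(k • f) i‖ * (p : ℝ) ^ (-(s * (i : ℝ))) =
        ‖k‖ * (‖f i‖ * (p : ℝ) ^ (-(s * (i : ℝ)))) := by
      intro s i
      rw [Pi.smul_apply, norm_smul, mul_assoc]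
    refine ⟨fun c hc => ?_, fun s hs => ?_⟩
    · rcases eq_or_ne k 0 with rfl | hk
      · have : {i : ℚ | c ≤ ‖((0 : ℚ_[p]) • f) i‖} = ∅ := by
          ext i
          simpa using hc
        rw [this]
        exact Set.isWF_empty
      · have hk' : 0 < ‖k‖ := norm_pos_iff.2 hk
        refine (hf.1 (c / ‖k‖) (by positivity)).mono fun i hi => ?_
        rw [Set.mem_ofPred_eq, Pi.smul_apply, norm_smul] at hi
        rw [Set.mem_ofPred_eq, div_le_iff₀ hk']
        linarith
    · obtain ⟨h1, h2, C, hC⟩ := hf.2 s hs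
      simp only [he]
      exact ⟨by simpa using h1.const_mul ‖k‖, by simpa using h2.const_mul ‖k‖, ‖k‖ * C,
        fun i => mul_le_mul_of_nonneg_left (hC i) (norm_nonneg _)⟩

variable (B)

/-- The extended Robba ring `R̃^r_B`, for the interval `(0, r]`. -/
abbrev extRobbaLE [Fact p.Prime] [NormedSpace ℚ_[p] B] [IsUltrametricDist B] (r : ℝ) :
    Submodule ℚ_[p] (ℚ → B) :=
  extRobba p (Set.Ioc 0 r)

/-- The extended Robba ring `R̃_B`, the union of all `R̃^r_B`. -/
def extRobbaUnion [Fact p.Prime] [NormedSpace ℚ_[p] B] [IsUltrametricDist B] : Set (ℚ → B) :=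
  ⋃ r : Set.Ioi (0 : ℝ), (extRobbaLE p B (r : ℝ) : Set (ℚ → B))

end Robba

/-! ### The completed tensor product `R̃^r_L ⊗̂ S` inside `R̃^r_{S_L}` -/

section Completed

variable (p : ℕ) [Fact p.Prime] (L S : Type*) [NormedCommRing L] [NormedAlgebra ℚ_[p] L]
    [IsUltrametricDist L] [NormedCommRing S] [NormedAlgebra ℚ_[p] S]

/-- The natural map `R̃^r_L ⊗ S → R̃^r_{S_L}`, `(∑ aᵢ uⁱ) ⊗ s ↦ ∑ (aᵢ ⊗ s) uⁱ`, with values written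
as coefficient functions. -/
def toSeries (r : ℝ) : (extRobbaLE p L r) ⊗[ℚ_[p]] S →ₗ[ℚ_[p]] (ℚ → CTensor p L S) :=
  LinearMap.pi fun i =>
    (UniformSpace.Completion.toComplₗᵢ (𝕜 := ℚ_[p]) (E := ProjTensor p L S)).toLinearMap ∘ₗ
      (ProjTensor.of p L S).toLinearMap ∘ₗ
        TensorProduct.map ((LinearMap.proj i) ∘ₗ (extRobbaLE p L r).subtype) LinearMap.id

theorem toSeries_tmul (r : ℝ) (f : extRobbaLE p L r) (s : S) (i : ℚ) :
    toSeries p L S r (f ⊗ₜ s) i =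
      ((ProjTensor.of p L S ((f : ℚ → L) i ⊗ₜ[ℚ_[p]] s) : ProjTensor p L S) : CTensor p L S) :=
  rfl

variable {p L S} in
/-- Cauchy sequences in `R̃^r_L ⊗ S` for the projective tensor product topology. The Fréchet topology
of `R̃^r_L` is given by the increasing family of norms `max(|·|_s, |·|_r)`, `0 < s ≤ r`. -/
def IsProjCauchy (r : ℝ) (x : ℕ → (extRobbaLE p L r) ⊗[ℚ_[p]] S) : Prop :=
  ∀ s ∈ Set.Ioc 0 r, ∀ ε : ℝ, 0 < ε → ∃ N : ℕ, ∀ m ≥ N, ∀ n ≥ N,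
    projNorm (fun f : extRobbaLE p L r =>
      max (gaussNorm p s (f : ℚ → L)) (gaussNorm p r (f : ℚ → L))) (norm : S → ℝ) (x m - x n) < ε

/-- The completed tensor product `R̃^r_L ⊗̂ S`, regarded as a subset of `R̃^r_{S_L}`. The projective
tensor product topology is given by countably many seminorms, so the elements of the completion
are the classes of Cauchy sequences in `R̃^r_L ⊗ S`; such a class is mapped to the limit
in `R̃^r_{S_L}` (for all `w_s`, `0 < s ≤ r`) of the images of the terms of the sequence. -/
def completedRobba (r : ℝ) : Set (ℚ → CTensor p L S) :=
  {b | b ∈ extRobbaLE p (CTensor p L S) r ∧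
    ∃ x : ℕ → (extRobbaLE p L r) ⊗[ℚ_[p]] S, IsProjCauchy r x ∧
      ∀ s ∈ Set.Ioc 0 r, Tendsto (fun n => w p s (toSeries p L S r (x n) - b)) atTop (𝓝 ⊤)}

end Completed

end

end RelRobba

open RelRobba
universe u v

/-! Put `t m = α^{-m} φ^m(b_{i p^{-m}})`. Applying `α^{-(m+1)} φ^m` to the equation at exponent `i
p^{-m}` shows that the term `α^{-(m+1)} φ^m(a_{i p^{-m}})` is `t (m+1) - t m` (`coeffTerm_eq_sub`),
so everything telescopes. For `m → ∞` the exponents stay bounded and `|α⁻¹| < 1`, hence `t m → 0`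
and the sum over `m ≥ 0` is `-t 0 = -b_i`; this gives the formula and uniqueness. For `i < 0` and `m
→ -∞` the exponents tend to `-∞` geometrically, so the coefficients of `b` decay doubly
exponentially and beat every power of `α`; hence the sum over all of `ℤ` vanishes.

Conversely, the series over `m ≥ 0` always solves the equation formally, but its estimates
deteriorate as `i → -∞`. The vanishing condition allows replacing it, for `i ≤ -1`, by the series
over `m < 0` (`hasSum_stepTerm`). After this exchange the `m`-th term changes `|·|_s` by at most
`growth p α s m`, which tends to `0` for each `s > 0` (`tendsto_growth`). So the modified series
converges in all Gauss norms, its sum lies in `R̃^r`, and a bound for `growth` at `s = r` gives the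
constant. The identity `φ(b) = a + α b` then improves the radius from `r` to `p r`.

For the last assertion, each modified term comes from an operator on `R̃^r_L ⊗ S` with the same
growth factor (`stepLinear`). If `x n` approximates `a`, the `n`-th partial sums applied to `x n`
form a Cauchy sequence that converges to `b`. -/

namespace RelRobba

/-! ### Estimates for formal sums -/

section Series

variable {p : ℕ} {B : Type*} [NormedAddCommGroup B]

/-- `|f|_s ≤ A`. -/
def GaussBound (p : ℕ) (s : ℝ) (f : ℚ → B) (A : ℝ) : Prop :=
  ∀ i : ℚ, ‖f i‖ * (p : ℝ) ^ (-(s * (i : ℝ))) ≤ A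

theorem GaussBound.nonneg {s A : ℝ} {f : ℚ → B} (h : GaussBound p s f A) : 0 ≤ A :=
  le_trans (by positivity) (h 0)

theorem GaussBound.norm_le (hp : 1 < p) {s A : ℝ} {f : ℚ → B} (h : GaussBound p s f A) (i : ℚ) :
    ‖f i‖ ≤ A * (p : ℝ) ^ (s * (i : ℝ)) := by
  have hp0 : (0 : ℝ) < p := by exact_mod_cast hp.pos
  have := h i
  rwa [Real.rpow_neg hp0.le, ← div_eq_mul_inv, div_le_iff₀ (by positivity)] at this

theorem GaussBound.add [IsUltrametricDist B] {s A : ℝ} {f g : ℚ → B} (hf : GaussBound p s f A)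
    (hg : GaussBound p s g A) : GaussBound p s (f + g) A := by
  intro i
  rcases le_max_iff.1 (IsUltrametricDist.norm_add_le_max (f i) (g i)) with h | h
  · exact (mul_le_mul_of_nonneg_right h (by positivity)).trans (hf i)
  · exact (mul_le_mul_of_nonneg_right h (by positivity)).trans (hg i)

theorem GaussBound.mono {s A A' : ℝ} {f : ℚ → B} (h : GaussBound p s f A) (hA : A ≤ A') :
    GaussBound p s f A' := fun i => (h i).trans hA

theorem GaussBound.sum [IsUltrametricDist B] {s A : ℝ} (hA : 0 ≤ A) {f : ℕ → ℚ → B} (u : Finset ℕ)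
    (hf : ∀ n ∈ u, GaussBound p s (f n) A) : GaussBound p s (∑ n ∈ u, f n) A := by
  induction u using Finset.cons_induction with
  | empty => intro i; simpa using hA
  | cons n u hn ih =>
    rw [Finset.sum_cons]
    exact (hf n (by simp)).add (ih fun m hm => hf m (by simp [hm]))

theorem IsExtRobba.gaussBound (hp : 1 < p) {I : Set ℝ} {f : ℚ → B} (hf : IsExtRobba p I f) {s : ℝ}
    (hs : s ∈ I) : ∃ A, GaussBound p s f A :=
  (((isExtRobba_iff hp I f).1 hf).2 s hs).2.2

theorem coe_le_w_iff (hp : 1 < p) {s M : ℝ} {f : ℚ → B} :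
    (M : EReal) ≤ w p s f ↔ GaussBound p s f ((p : ℝ) ^ (-M)) := by
  simp only [w, le_iInf_iff, le_wterm_iff hp]
  rfl

/-- A bound of Gauss norms by a constant factor `K`, in terms of `w_s`. -/
theorem w_sub_le (hp : 1 < p) {s K : ℝ} (hK : 0 < K) {f g : ℚ → B}
    (h : ∀ A, GaussBound p s f A → GaussBound p s g (K * A)) :
    w p s f - ((Real.logb p K : ℝ) : EReal) ≤ w p s g := by
  have hp1 : (1 : ℝ) < p := by exact_mod_cast hp
  have hp0 : (0 : ℝ) < p := by linarith
  refine EReal.sub_le_of_le_add ?_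
  refine EReal.ge_of_forall_gt_iff_ge.1 fun M hM => ?_
  have h1 := h _ ((coe_le_w_iff hp).1 hM.le)
  have h2 : K * (p : ℝ) ^ (-M) = (p : ℝ) ^ (-(M - Real.logb p K)) := by
    rw [neg_sub, sub_eq_add_neg, Real.rpow_add hp0, Real.rpow_logb hp0 hp1.ne' hK]
  rw [h2] at h1
  have h3 := (coe_le_w_iff hp).2 h1
  calc (M : EReal) = ((M - Real.logb p K : ℝ) : EReal) + ((Real.logb p K : ℝ) : EReal) := by
        rw [← EReal.coe_add]; simp
    _ ≤ _ := by gcongr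

theorem tendsto_w_iff (hp : 1 < p) {s : ℝ} {f : ℕ → ℚ → B} :
    Tendsto (fun n => w p s (f n)) atTop (𝓝 ⊤) ↔
      ∀ ε > 0, ∀ᶠ n in atTop, GaussBound p s (f n) ε := by
  have hp1 : (1 : ℝ) < p := by exact_mod_cast hp
  have hp0 : (0 : ℝ) < p := by linarith
  rw [EReal.tendsto_nhds_top_iff_real]
  constructor
  · intro h ε hε
    refine (h (-Real.logb p ε)).mono fun n hn => ?_
    have := (coe_le_w_iff hp).1 hn.le
    rwa [neg_neg, Real.rpow_logb hp0 hp1.ne' hε] at this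
  · intro h M
    -- `M + 1` turns the non-strict Gauss bound into the strict inequality `M < w_s`.
    refine (h ((p : ℝ) ^ (-(M + 1))) (by positivity)).mono fun n hn => ?_
    exact lt_of_lt_of_le (by exact_mod_cast lt_add_one M) ((coe_le_w_iff hp).2 hn)

/-- Rescaling exponents by a positive `c` is monotone, so it preserves well-ordered sets and limits
at `±∞`. This serves three purposes: twists, multiplication by a constant (`c = 1`), and the change
of radius by `φ` (`c = p`). -/
theorem IsExtRobba.of_le_comp (hp : 1 < p) {I J : Set ℝ} {f g : ℚ → B} (hf : IsExtRobba p I f)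
    {c : ℚ} (hc : 0 < c) {D : ℝ} (hD : 0 ≤ D) (hgf : ∀ i, ‖g i‖ ≤ D * ‖f (i * c)‖)
    (h : ∀ s ∈ J, ∃ t ∈ I, ∃ K : ℝ, 0 ≤ K ∧ ∀ i : ℚ, ‖g i‖ * (p : ℝ) ^ (-(s * (i : ℝ))) ≤
      K * (‖f (i * c)‖ * (p : ℝ) ^ (-(t * ((i * c : ℚ) : ℝ))))) :
    IsExtRobba p J g := by
  rw [isExtRobba_iff hp] at hf ⊢
  refine ⟨fun e he => ?_, fun s hs => ?_⟩
  · have hwf := hf.1 (e / (D + 1)) (by positivity)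
    rw [← Set.isPWO_iff_isWF] at hwf ⊢
    refine (hwf.image_of_monotone (f := fun i => i / c)
      (fun x y hxy => by simp only; gcongr)).mono fun i hi => ?_
    refine ⟨i * c, ?_, by field_simp⟩
    have h1 : e ≤ ‖g i‖ := hi
    rw [Set.mem_ofPred_eq, div_le_iff₀ (by positivity)]
    nlinarith [hgf i, norm_nonneg (f (i * c))]
  · obtain ⟨t, ht, K, hK, hle⟩ := h s hs
    obtain ⟨h1, h2, A, hA⟩ := hf.2 t ht
    refine ⟨?_, ?_, K * A, fun i => (hle i).trans (by gcongr; exact hA _)⟩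
    · refine squeeze_zero (fun i => by positivity) hle ?_
      simpa using (h1.comp (tendsto_id.atTop_mul_const hc)).const_mul K
    · refine squeeze_zero (fun i => by positivity) hle ?_
      simpa using (h2.comp (tendsto_id.atBot_mul_const hc)).const_mul K

/-- The conditions that define `R̃^r_B` are stable under limits for all Gauss norms. -/
theorem IsExtRobba.of_approx [IsUltrametricDist B] (hp : 1 < p) {r : ℝ} (hr : 0 < r) {g : ℚ → B}
    (h : ∀ s ∈ Set.Ioc 0 r, ∀ ε > 0, ∃ f, IsExtRobba p (Set.Ioc 0 r) f ∧
      GaussBound p s (g - f) ε) : IsExtRobba p (Set.Ioc 0 r) g := by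
  have hp1 : (1 : ℝ) < p := by exact_mod_cast hp
  have hp0 : (0 : ℝ) < p := by linarith
  have hle : ∀ (s : ℝ) (f : ℚ → B) (i : ℚ), ‖g i‖ * (p : ℝ) ^ (-(s * (i : ℝ))) ≤
      ‖(g - f) i‖ * (p : ℝ) ^ (-(s * (i : ℝ))) + ‖f i‖ * (p : ℝ) ^ (-(s * (i : ℝ))) := by
    intro s f i
    rw [← add_mul]
    gcongr
    simpa using norm_add_le ((g - f) i) (f i)
  have hlim : ∀ l : Filter ℚ, ∀ s ∈ Set.Ioc 0 r, (∀ f : ℚ → B, IsExtRobba p (Set.Ioc 0 r) f →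
      Tendsto (fun i : ℚ => ‖f i‖ * (p : ℝ) ^ (-(s * (i : ℝ)))) l (𝓝 0)) →
      Tendsto (fun i : ℚ => ‖g i‖ * (p : ℝ) ^ (-(s * (i : ℝ)))) l (𝓝 0) := by
    intro l s hs H
    rw [Metric.tendsto_nhds]
    intro ε hε
    obtain ⟨f, hf, hgf⟩ := h s hs (ε / 2) (by positivity)
    filter_upwards [Metric.tendsto_nhds.1 (H f hf) (ε / 2) (by positivity)] with i hi
    rw [Real.dist_eq, sub_zero, abs_of_nonneg (by positivity)] at hi ⊢
    linarith [hle s f i, hgf i]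
  rw [isExtRobba_iff hp]
  refine ⟨fun e he => ?_, fun s hs => ⟨hlim _ s hs fun f hf =>
    (((isExtRobba_iff hp _ f).1 hf).2 s hs).1, hlim _ s hs fun f hf =>
    (((isExtRobba_iff hp _ f).1 hf).2 s hs).2.1, ?_⟩⟩
  · rw [Set.isWF_iff_no_descending_seq]
    intro u hu hmem
    -- A descending sequence of exponents is bounded above by `u 0`, so this accuracy forces `|g -
    -- f| ≤ e / 2` along the whole sequence. By the ultrametric inequality `f` then has coefficients
    -- of norm at least `e` there too.
    obtain ⟨f, hf, hgf⟩ := h r ⟨hr, le_rfl⟩ (e / 2 * (p : ℝ) ^ (-(r * (u 0 : ℝ)))) (by positivity)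
    refine Set.isWF_iff_no_descending_seq.1 (hf.wf e he) u hu fun n => ?_
    have h1 : e ≤ ‖g (u n)‖ := hmem n
    have h2 : ‖(g - f) (u n)‖ ≤ e / 2 := by
      refine (hgf.norm_le hp (u n)).trans ?_
      rw [mul_assoc, ← Real.rpow_add hp0]
      have h3 : (u n : ℝ) ≤ u 0 := by exact_mod_cast hu.antitone (Nat.zero_le n)
      have h4 : (p : ℝ) ^ (-(r * (u 0 : ℝ)) + r * (u n : ℝ)) ≤ 1 :=
        Real.rpow_le_one_of_one_le_of_nonpos hp1.le (by nlinarith)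
      nlinarith
    have h5 : ‖g (u n)‖ ≤ max ‖(g - f) (u n)‖ ‖f (u n)‖ := by
      simpa using IsUltrametricDist.norm_add_le_max ((g - f) (u n)) (f (u n))
    rcases le_max_iff.1 h5 with h6 | h6
    · linarith
    · exact h1.trans h6
  · obtain ⟨f, hf, hgf⟩ := h s hs 1 one_pos
    obtain ⟨A, hA⟩ := hf.gaussBound hp hs
    exact ⟨1 + A, fun i => (hle s f i).trans (add_le_add (hgf i) (hA i))⟩

/-- The formal sum with coefficients `σ(f_{ic})` for `i ∈ P`, and `0` for `i ∉ P`. -/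
noncomputable def twist (σ : B → B) (c : ℚ) (P : Set ℚ) (f : ℚ → B) : ℚ → B :=
  P.indicator fun i => σ (f (i * c))

theorem twist_norm_le {σ : B → B} (hσ : ∀ x, ‖σ x‖ = ‖x‖) (c : ℚ) (P : Set ℚ) (f : ℚ → B) (i : ℚ) :
    ‖twist σ c P f i‖ ≤ ‖f (i * c)‖ := by
  by_cases hi : i ∈ P
  · rw [twist, Set.indicator_of_mem hi, hσ]
  · rw [twist, Set.indicator_of_notMem hi, norm_zero]
    positivity

/-- The weights at `i` and `i c` differ by the factor `p^{s (c - 1) i}`, which `κ` controls on `P`.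
-/
theorem twist_term_le (hp : 1 < p) {σ : B → B} (hσ : ∀ x, ‖σ x‖ = ‖x‖) {c : ℚ} {P : Set ℚ} {κ s : ℝ}
    (hs : 0 ≤ s) (hκ : ∀ i ∈ P, ((c : ℝ) - 1) * (i : ℝ) ≤ κ) (f : ℚ → B) (i : ℚ) :
    ‖twist σ c P f i‖ * (p : ℝ) ^ (-(s * (i : ℝ))) ≤
      (p : ℝ) ^ (s * κ) * (‖f (i * c)‖ * (p : ℝ) ^ (-(s * ((i * c : ℚ) : ℝ)))) := by
  have hp1 : (1 : ℝ) < p := by exact_mod_cast hp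
  have hp0 : (0 : ℝ) < p := by linarith
  by_cases hi : i ∈ P
  · rw [mul_left_comm, ← Real.rpow_add hp0]
    refine mul_le_mul (twist_norm_le hσ c P f i) ?_ (by positivity) (by positivity)
    refine Real.rpow_le_rpow_of_exponent_le hp1.le ?_
    push_cast
    nlinarith [mul_le_mul_of_nonneg_left (hκ i hi) hs]
  · rw [twist, Set.indicator_of_notMem hi, norm_zero, zero_mul]
    positivity

theorem GaussBound.twist (hp : 1 < p) {σ : B → B} (hσ : ∀ x, ‖σ x‖ = ‖x‖) {c : ℚ} {P : Set ℚ}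
    {κ s : ℝ} (hs : 0 ≤ s) (hκ : ∀ i ∈ P, ((c : ℝ) - 1) * (i : ℝ) ≤ κ) {f : ℚ → B} {A : ℝ}
    (h : GaussBound p s f A) : GaussBound p s (twist σ c P f) ((p : ℝ) ^ (s * κ) * A) :=
  fun i => (twist_term_le hp hσ hs hκ f i).trans (by gcongr; exact h _)

theorem IsExtRobba.twist (hp : 1 < p) {σ : B → B} (hσ : ∀ x, ‖σ x‖ = ‖x‖) {c : ℚ} (hc : 0 < c)
    {P : Set ℚ} {κ r : ℝ} (hκ : ∀ i ∈ P, ((c : ℝ) - 1) * (i : ℝ) ≤ κ) {f : ℚ → B}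
    (h : IsExtRobba p (Set.Ioc 0 r) f) : IsExtRobba p (Set.Ioc 0 r) (twist σ c P f) :=
  h.of_le_comp hp hc zero_le_one (by simpa using twist_norm_le hσ c P f) fun s hs =>
    ⟨s, hs, (p : ℝ) ^ (s * κ), by positivity, twist_term_le hp hσ hs.1.le hκ f⟩

end Series

theorem _root_.HasSum.norm_le_of_forall_le {E : Type*} [NormedAddCommGroup E] [IsUltrametricDist E]
    {ι : Type*} {f : ι → E} {x : E} (h : HasSum f x) {C : ℝ} (hC : 0 ≤ C) (hf : ∀ n, ‖f n‖ ≤ C) :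
    ‖x‖ ≤ C := by
  rw [← h.tsum_eq]
  exact IsUltrametricDist.norm_tsum_le_of_forall_le_of_nonneg hC hf

/-- Summation of coefficients, term by term, with uniform bounds for the Gauss norm. -/
theorem GaussBound.hasSum {p : ℕ} {B : Type*} [NormedAddCommGroup B] [IsUltrametricDist B]
    (hp : 1 < p)
    {s A : ℝ} (hA : 0 ≤ A) {f : ℕ → ℚ → B} {g : ℚ → B} (hf : ∀ n, GaussBound p s (f n) A)
    (hg : ∀ i, HasSum (fun n => f n i) (g i)) : GaussBound p s g A := by
  have hp0 : (0 : ℝ) < p := by exact_mod_cast hp.pos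
  intro i
  rw [Real.rpow_neg hp0.le, ← div_eq_mul_inv, div_le_iff₀ (by positivity)]
  exact (hg i).norm_le_of_forall_le (by positivity) fun n => (hf n).norm_le hp i

/-! ### The growth factors -/

/-- `‖1‖` is not assumed to be `1`; it enters the base, and the exponent `n + 1` covers `n = 0`. -/
theorem norm_pow_le_max_pow {R : Type*} [SeminormedRing R] (x : R) (n : ℕ) :
    ‖x ^ n‖ ≤ (max 1 (max ‖x‖ ‖(1 : R)‖)) ^ (n + 1) := by
  induction n with
  | zero => simp
  | succ n ih =>
    rw [pow_succ, pow_succ _ (n + 1)]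
    refine (norm_mul_le _ _).trans ?_
    gcongr
    exact (le_max_left _ _).trans (le_max_right _ _)

/-- Powers of `x` grow at most polynomially in `N = p^{n+1}`: if `p^k` exceeds the base of
`norm_pow_le_max_pow`, then `‖x^n‖ ≤ N^k`, while `y^N` decays exponentially in `N`. -/
theorem tendsto_norm_pow_mul_pow_pow {p : ℕ} (hp : 1 < p) {R : Type*} [SeminormedRing R] (x : R)
    {y : ℝ} (hy0 : 0 ≤ y) (hy1 : y < 1) :
    Tendsto (fun n : ℕ => ‖x ^ n‖ * y ^ p ^ (n + 1)) atTop (𝓝 0) := by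
  obtain ⟨k, hk⟩ := pow_unbounded_of_one_lt (max 1 (max ‖x‖ ‖(1 : R)‖))
    (show (1 : ℝ) < p by exact_mod_cast hp)
  have hy : |y| < 1 := by rwa [abs_of_nonneg hy0]
  have h := (tendsto_pow_const_mul_const_pow_of_abs_lt_one k hy).comp
    ((tendsto_pow_atTop_atTop_of_one_lt hp).comp (tendsto_add_atTop_nat 1))
  refine squeeze_zero (fun n => by positivity) (fun n => ?_) h
  simp only [Function.comp_apply]
  gcongr
  refine (norm_pow_le_max_pow x n).trans ?_
  push_cast
  rw [← pow_mul, mul_comm (n + 1) k, pow_mul]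
  gcongr

/-- The factor by which the `m`-th term of the series for the solution changes `|·|_s`. -/
noncomputable def growth (p : ℕ) {R : Type*} [NormedRing R] (α : Rˣ) (s : ℝ) (m : ℕ) : ℝ :=
  max ((p : ℝ) ^ s * ‖((α⁻¹ : Rˣ) : R) ^ (m + 1)‖)
    ((p : ℝ) ^ (s * (1 - (p : ℝ) ^ (m + 1))) * ‖(α : R) ^ m‖)

section Growth

variable {p : ℕ} {R : Type*} [NormedRing R]

theorem growth_nonneg (α : Rˣ) (s : ℝ) (m : ℕ) : 0 ≤ growth p α s m :=
  le_max_of_le_left (by positivity)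

theorem tendsto_growth (hp : 1 < p) {α : Rˣ} (hα : ‖((α⁻¹ : Rˣ) : R)‖ < 1) {s : ℝ} (hs : 0 < s) :
    Tendsto (growth p α s) atTop (𝓝 0) := by
  have hp1 : (1 : ℝ) < p := by exact_mod_cast hp
  have hp0 : (0 : ℝ) < p := by linarith
  have h1 : Tendsto (fun m : ℕ => (p : ℝ) ^ s * ‖((α⁻¹ : Rˣ) : R) ^ (m + 1)‖) atTop (𝓝 0) := by
    have := ((tendsto_pow_atTop_nhds_zero_of_lt_one (norm_nonneg _) hα).comp
      (tendsto_add_atTop_nat 1)).const_mul ((p : ℝ) ^ s)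
    rw [mul_zero] at this
    refine squeeze_zero (fun m => by positivity) (fun m => ?_) this
    exact mul_le_mul_of_nonneg_left (norm_pow_le' _ (Nat.succ_pos m)) (by positivity)
  have h2 : Tendsto (fun m : ℕ => (p : ℝ) ^ (s * (1 - (p : ℝ) ^ (m + 1))) * ‖(α : R) ^ m‖)
      atTop (𝓝 0) := by
    have hy : (p : ℝ) ^ (-s) < 1 := Real.rpow_lt_one_of_one_lt_of_neg hp1 (by linarith)
    -- The second factor is `p^s * y^{p^{m+1}} * ‖α^m‖` with `y = p^{-s} < 1`.
    have := (tendsto_norm_pow_mul_pow_pow hp (α : R) (by positivity) hy).const_mul ((p : ℝ) ^ s)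
    rw [mul_zero] at this
    refine this.congr fun m => ?_
    rw [mul_left_comm, mul_comm _ ‖_‖]
    congr 1
    rw [← Real.rpow_natCast, ← Real.rpow_mul hp0.le, ← Real.rpow_add hp0]
    congr 1
    push_cast
    ring
  have h := h1.max h2
  rwa [max_self] at h

theorem exists_growth_le (hp : 1 < p) {α : Rˣ} (hα : ‖((α⁻¹ : Rˣ) : R)‖ < 1) {s : ℝ} (hs : 0 < s) :
    ∃ K : ℝ, 0 < K ∧ ∀ m, growth p α s m ≤ K := by
  obtain ⟨K, hK⟩ := (tendsto_growth hp hα hs).bddAbove_range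
  -- The maximum with `1` makes the bound positive, so that its logarithm and division by it make
  -- sense.
  exact ⟨max K 1, by positivity, fun m => (hK ⟨m, rfl⟩).trans (le_max_left _ _)⟩

/-- Makes the final constant independent of `L`: a bound computed in `S` remains valid in `S_L`. -/
theorem growth_map_le {R' : Type*} [NormedRing R'] (ι : R →+* R') (hι : ∀ x, ‖ι x‖ ≤ ‖x‖) (α : Rˣ)
    (s : ℝ) (m : ℕ) : growth p (Units.map ι.toMonoidHom α) s m ≤ growth p α s m := by
  unfold growth
  rw [← map_inv]
  gcongr
  · simpa using hι (((α⁻¹ : Rˣ) : R) ^ (m + 1))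
  · simpa using hι ((α : R) ^ m)

end Growth

end RelRobba

namespace RelRobba

/-! ### The equation over a Banach algebra with an isometric automorphism -/

theorem norm_ringEquiv_zpow {B : Type*} [NormedRing B] {φ : B ≃+* B} (hφ : ∀ x, ‖φ x‖ = ‖x‖) (m : ℤ)
    (x : B) : ‖(φ ^ m) x‖ = ‖x‖ := by
  induction m generalizing x with
  | zero => simp
  | succ n ih => rw [zpow_add_one, RingAut.mul_apply, ih, hφ]
  | pred n ih =>
    rw [zpow_sub_one, RingAut.mul_apply, ih]
    conv_rhs => rw [← RingEquiv.apply_symm_apply φ x, hφ]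
    rfl

theorem ringEquiv_zpow_apply_eq {B : Type*} [Ring B] {φ : B ≃+* B} {x : B} (h : φ x = x) (m : ℤ) :
    (φ ^ m) x = x := by
  have h' : φ⁻¹ x = x := φ.injective (by
    rw [← RingAut.mul_apply, mul_inv_cancel, RingAut.one_apply, h])
  induction m with
  | zero => simp
  | succ n ih => rw [zpow_add_one, RingAut.mul_apply, h, ih]
  | pred n ih => rw [zpow_sub_one, RingAut.mul_apply, h', ih]

/-- In a complete ultrametric group, terms tending to `0` are already unconditionally summable, so
the limit of the partial sums identifies the sum. -/
theorem hasSum_telescope {E : Type*} [NormedAddCommGroup E] [IsUltrametricDist E] [CompleteSpace E]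
    {g : ℕ → E} (hg : Tendsto g atTop (𝓝 0)) : HasSum (fun n => g (n + 1) - g n) (-(g 0)) := by
  have h0 : Tendsto (fun n => g (n + 1) - g n) atTop (𝓝 0) := by
    simpa using (hg.comp (tendsto_add_atTop_nat 1)).sub hg
  have hs : Summable fun n => g (n + 1) - g n :=
    NonarchimedeanAddGroup.summable_of_tendsto_cofinite_zero (by rwa [Nat.cofinite_eq_atTop])
  refine (hs.hasSum_iff_tendsto_nat).2 ?_
  simp only [Finset.sum_range_sub]
  simpa using hg.sub_const (g 0)

section Equation

variable {p : ℕ} {B : Type*} [NormedCommRing B]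

/-- The coefficient of `uⁱ` in `α^{-m} φᵐ(b)`. -/
noncomputable def twistTerm (p : ℕ) (α : Bˣ) (φ : B ≃+* B) (b : ℚ → B) (i : ℚ) (m : ℤ) : B :=
  ((α ^ (-m) : Bˣ) : B) * (φ ^ m) (b (i * (p : ℚ) ^ (-m)))

/-- The coefficient of `uⁱ` in `α^{-(m+1)} φᵐ(a)`. -/
noncomputable def coeffTerm (p : ℕ) (α : Bˣ) (φ : B ≃+* B) (a : ℚ → B) (i : ℚ) (m : ℤ) : B :=
  ((α ^ (-(m + 1)) : Bˣ) : B) * (φ ^ m) (a (i * (p : ℚ) ^ (-m)))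

/-- The series `-α^{-(m+1)} φᵐ(a)`, restricted to exponents `i > -1`, plus the series
`αᵐ φ^{-(m+1)}(a)`, restricted to exponents `i ≤ -1`. -/
noncomputable def stepTerm (p : ℕ) (α : Bˣ) (φ : B ≃+* B) (m : ℕ) (a : ℚ → B) : ℚ → B :=
  -(((α⁻¹ : Bˣ) : B) ^ (m + 1) • twist (φ ^ (m : ℤ)) ((p : ℚ) ^ (-(m : ℤ))) (Set.Ioi (-1)) a) +
    (α : B) ^ m • twist (φ ^ (-((m : ℤ) + 1))) ((p : ℚ) ^ ((m : ℤ) + 1)) (Set.Iic (-1)) a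

/-! ### Estimates for the individual terms of the series. -/

variable {α : Bˣ} {φ : B ≃+* B}

theorem coeffTerm_eq_mul (a : ℚ → B) (i : ℚ) (m : ℤ) :
    coeffTerm p α φ a i m = ((α⁻¹ : Bˣ) : B) * twistTerm p α φ a i m := by
  rw [coeffTerm, twistTerm, ← mul_assoc, ← Units.val_mul, neg_add, zpow_add, zpow_neg_one, mul_comm
    (α ^ (-m))]

theorem stepTerm_apply_of_lt (m : ℕ) (a : ℚ → B) {i : ℚ} (hi : -1 < i) :
    stepTerm p α φ m a i = -coeffTerm p α φ a i m := by
  have h : i ∉ Set.Iic (-1 : ℚ) := by simpa using hi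
  simp only [stepTerm, twist, Pi.add_apply, Pi.neg_apply, Pi.smul_apply, Set.indicator_of_notMem h,
    Set.indicator_of_mem (Set.mem_Ioi.2 hi), smul_eq_mul, mul_zero, add_zero, coeffTerm]
  rw [zpow_neg α, ← inv_zpow, ← Nat.cast_succ, zpow_natCast α⁻¹,
    Units.val_pow_eq_pow_val]

theorem stepTerm_apply_of_le (m : ℕ) (a : ℚ → B) {i : ℚ} (hi : i ≤ -1) :
    stepTerm p α φ m a i = coeffTerm p α φ a i (-((m : ℤ) + 1)) := by
  have h : i ∉ Set.Ioi (-1 : ℚ) := by simpa using hi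
  simp only [stepTerm, twist, Pi.add_apply, Pi.neg_apply, Pi.smul_apply, Set.indicator_of_notMem h,
    Set.indicator_of_mem (Set.mem_Iic.2 hi), smul_eq_mul, mul_zero, neg_zero, zero_add, coeffTerm]
  rw [neg_neg, show -(-((m : ℤ) + 1) + 1) = m by ring, zpow_natCast, Units.val_pow_eq_pow_val]

/-- With `c = p^{-m}` in `(0, 1]`, the product `(1 - c)(-i)` is at most `1` once `-i < 1`. The bound
is uniform in `m`; decay comes from `α^{-(m+1)}` alone. -/
theorem pow_sub_one_mul_le_one (hp : 1 < p) (m : ℕ) (i : ℚ) (hi : i ∈ Set.Ioi (-1 : ℚ)) :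
    ((((p : ℚ) ^ (-(m : ℤ)) : ℚ) : ℝ) - 1) * (i : ℝ) ≤ 1 := by
  have h1 : (p : ℚ) ^ (-(m : ℤ)) ≤ 1 :=
    zpow_le_one_of_nonpos₀ (by exact_mod_cast hp.le) (by simp)
  have h2 : (0 : ℚ) < (p : ℚ) ^ (-(m : ℤ)) := zpow_pos (by exact_mod_cast hp.pos) _
  have h3 : -1 < i := hi
  have : ((p : ℚ) ^ (-(m : ℤ)) - 1) * i ≤ 1 := by nlinarith
  exact_mod_cast this

/-- The worst case is `i = -1`. Staying away from `0` is what makes the bound tend to `-∞` with `m`,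
fast enough to absorb `α^m`. -/
theorem pow_sub_one_mul_le (hp : 1 < p) (m : ℕ) (i : ℚ) (hi : i ∈ Set.Iic (-1 : ℚ)) :
    ((((p : ℚ) ^ ((m : ℤ) + 1) : ℚ) : ℝ) - 1) * (i : ℝ) ≤ 1 - (p : ℝ) ^ (m + 1) := by
  have h1 : 1 ≤ (p : ℚ) ^ (m + 1) := one_le_pow₀ (by exact_mod_cast hp.le)
  have h3 : i ≤ -1 := hi
  have : ((p : ℚ) ^ ((m : ℤ) + 1) - 1) * i ≤ 1 - (p : ℚ) ^ (m + 1) := by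
    rw [← Nat.cast_succ, zpow_natCast]
    simp only [Nat.succ_eq_add_one]
    nlinarith
  exact_mod_cast this

theorem GaussBound.smul {s A : ℝ} {f : ℚ → B} (c : B) (h : GaussBound p s f A) :
    GaussBound p s (c • f) (‖c‖ * A) := by
  intro i
  rw [Pi.smul_apply, smul_eq_mul]
  calc _ ≤ ‖c‖ * ‖f i‖ * (p : ℝ) ^ (-(s * (i : ℝ))) := by gcongr; exact norm_mul_le _ _
    _ ≤ _ := by rw [mul_assoc]; gcongr; exact h i

theorem GaussBound.neg {s A : ℝ} {f : ℚ → B} (h : GaussBound p s f A) : GaussBound p s (-f) A :=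
  fun i => by simpa using h i

theorem IsExtRobba.smul [Fact p.Prime] (c : B) {r : ℝ} {f : ℚ → B}
    (h : IsExtRobba p (Set.Ioc 0 r) f) :
    IsExtRobba p (Set.Ioc 0 r) (c • f) := by
  refine h.of_le_comp (Fact.out : p.Prime).one_lt one_pos (norm_nonneg c)
    (fun i => by simpa using norm_mul_le c (f i)) fun s hs => ⟨s, hs, ‖c‖, norm_nonneg c, fun i =>
      ?_⟩
  rw [mul_one, ← mul_assoc]
  gcongr
  exact norm_mul_le c (f i)

theorem GaussBound.stepTerm [Fact p.Prime] [IsUltrametricDist B] (hφ : ∀ x, ‖φ x‖ = ‖x‖) (m : ℕ)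
    {s A : ℝ} (hs : 0 ≤ s) {a : ℚ → B}
    (h : GaussBound p s a A) : GaussBound p s (stepTerm p α φ m a) (growth p α s m * A) := by
  have hp := (Fact.out : p.Prime).one_lt
  refine GaussBound.add (GaussBound.neg ?_) ?_
  · refine ((h.twist hp (norm_ringEquiv_zpow hφ m) hs (pow_sub_one_mul_le_one hp m)).smul _).mono ?_
    rw [← mul_assoc, mul_comm ‖_‖, mul_one]
    exact mul_le_mul_of_nonneg_right (le_max_left _ _) h.nonneg
  · refine ((h.twist hp (norm_ringEquiv_zpow hφ _) hs (pow_sub_one_mul_le hp m)).smul _).mono ?_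
    rw [← mul_assoc, mul_comm ‖_‖]
    exact mul_le_mul_of_nonneg_right (le_max_right _ _) h.nonneg

theorem IsExtRobba.stepTerm [Fact p.Prime] [IsUltrametricDist B] [NormedAlgebra ℚ_[p] B]
    (hφ : ∀ x, ‖φ x‖ = ‖x‖) (m : ℕ) {r : ℝ}
    {a : ℚ → B} (h : IsExtRobba p (Set.Ioc 0 r) a) :
    IsExtRobba p (Set.Ioc 0 r) (stepTerm p α φ m a) := by
  have hp := (Fact.out : p.Prime).one_lt
  have hp0 : (0 : ℚ) < p := by exact_mod_cast hp.pos
  exact (extRobbaLE p B r).add_mem ((extRobbaLE p B r).neg_mem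
    ((h.twist hp (norm_ringEquiv_zpow hφ _) (zpow_pos hp0 _) (pow_sub_one_mul_le_one hp m)).smul _))
    ((h.twist hp (norm_ringEquiv_zpow hφ _) (zpow_pos hp0 _) (pow_sub_one_mul_le hp m)).smul _)

/-! #### Necessity -/

/-- The telescoping identity: apply `α^{-(m+1)} φ^m` to the equation at exponent `i p^{-m}` and use
that `φ` fixes `α`. -/
theorem coeffTerm_eq_sub [Fact p.Prime] (hφα : φ (α : B) = α) {a b : ℚ → B}
    (hb : ∀ i, φ (b (i / p)) - α * b i = a i) (i : ℚ) (m : ℤ) :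
    coeffTerm p α φ a i m = twistTerm p α φ b i (m + 1) - twistTerm p α φ b i m := by
  have hp0 : (p : ℚ) ≠ 0 := by exact_mod_cast (Fact.out : p.Prime).ne_zero
  have h1 : (p : ℚ) ^ (-(m + 1)) = (p : ℚ) ^ (-m) / p := by
    rw [neg_add, zpow_add₀ hp0, zpow_neg_one, div_eq_mul_inv]
  have h2 : ((α ^ (-m) : Bˣ) : B) = ((α ^ (-(m + 1)) : Bˣ) : B) * α := by
    rw [← Units.val_mul, ← zpow_add_one]
    simp
  rw [coeffTerm, twistTerm, twistTerm, h1, h2, ← hb, map_sub, map_mul, zpow_add_one,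
    RingAut.mul_apply, ringEquiv_zpow_apply_eq hφα, mul_sub, mul_assoc, mul_div_assoc]

theorem twistTerm_zero (b : ℚ → B) (i : ℚ) : twistTerm p α φ b i 0 = b i := by
  simp [twistTerm]

/-- The exponents `i p^{-n}` never exceed `|i|`, so the coefficients of `b` are bounded, while
`α^{-n} → 0`. -/
theorem tendsto_twistTerm [Fact p.Prime] (hφ : ∀ x, ‖φ x‖ = ‖x‖) (hα : ‖((α⁻¹ : Bˣ) : B)‖ < 1)
    {s A : ℝ}
    (hs : 0 ≤ s) {b : ℚ → B} (h : GaussBound p s b A) (i : ℚ) :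
    Tendsto (fun n : ℕ => twistTerm p α φ b i n) atTop (𝓝 0) := by
  have hp := (Fact.out : p.Prime).one_lt
  have hp1 : (1 : ℝ) < p := by exact_mod_cast hp
  have hb : ∀ n : ℕ, ‖b (i * (p : ℚ) ^ (-(n : ℤ)))‖ ≤ A * (p : ℝ) ^ (s * |(i : ℝ)|) := by
    intro n
    refine (h.norm_le hp _).trans (mul_le_mul_of_nonneg_left ?_ h.nonneg)
    refine Real.rpow_le_rpow_of_exponent_le hp1.le (mul_le_mul_of_nonneg_left ?_ hs)
    have h1 : (p : ℝ) ^ (-(n : ℤ)) ≤ 1 := zpow_le_one_of_nonpos₀ hp1.le (by simp)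
    have h2 : (0 : ℝ) < (p : ℝ) ^ (-(n : ℤ)) := by positivity
    push_cast
    nlinarith [le_abs_self (i : ℝ), abs_nonneg (i : ℝ)]
  have h0 : Tendsto (fun n : ℕ => ‖((α⁻¹ : Bˣ) : B) ^ n‖ * (A * (p : ℝ) ^ (s * |(i : ℝ)|))) atTop
      (𝓝 0) := by
    have := (tendsto_pow_atTop_nhds_zero_of_norm_lt_one hα).norm.mul_const
      (A * (p : ℝ) ^ (s * |(i : ℝ)|))
    rwa [norm_zero, zero_mul] at this
  refine squeeze_zero_norm (fun n => ?_) h0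
  rw [twistTerm, zpow_neg, ← inv_zpow, zpow_natCast, Units.val_pow_eq_pow_val]
  refine (norm_mul_le _ _).trans ?_
  rw [norm_ringEquiv_zpow hφ]
  gcongr
  exact hb n

theorem tendsto_twistTerm_neg [Fact p.Prime] (hφ : ∀ x, ‖φ x‖ = ‖x‖) {s A : ℝ} (hs : 0 < s)
    {b : ℚ → B}
    (h : GaussBound p s b A) {i : ℚ} (hi : i < 0) :
    Tendsto (fun n : ℕ => twistTerm p α φ b i (-(n : ℤ))) atTop (𝓝 0) := by
  have hp := (Fact.out : p.Prime).one_lt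
  have hp1 : (1 : ℝ) < p := by exact_mod_cast hp
  have hp0 : (0 : ℝ) < p := by linarith
  have hi' : (i : ℝ) < 0 := by exact_mod_cast hi
  -- Dividing by `p` compensates the shift in the exponent `p^{n+1}`: the power of this base is
  -- `p^{s i p^n}`, the bound for the coefficient at `i p^n`.
  have hy : (p : ℝ) ^ (s * i / p) < 1 :=
    Real.rpow_lt_one_of_one_lt_of_neg hp1 (div_neg_of_neg_of_pos (by nlinarith) hp0)
  have h0 := (tendsto_norm_pow_mul_pow_pow hp (α : B) (by positivity) hy).const_mul A
  rw [mul_zero] at h0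
  refine squeeze_zero_norm (fun n => ?_) h0
  rw [twistTerm, neg_neg, zpow_natCast, Units.val_pow_eq_pow_val]
  refine (norm_mul_le _ _).trans ?_
  rw [norm_ringEquiv_zpow hφ, mul_left_comm]
  gcongr
  refine (h.norm_le hp _).trans_eq ?_
  rw [← Real.rpow_natCast, ← Real.rpow_mul hp0.le]
  congr 2
  push_cast
  rw [zpow_natCast, pow_succ]
  field_simp

theorem hasSum_coeffTerm_nat [Fact p.Prime] [IsUltrametricDist B] [CompleteSpace B]
    (hφ : ∀ x, ‖φ x‖ = ‖x‖) (hφα : φ (α : B) = α)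
    (hα : ‖((α⁻¹ : Bˣ) : B)‖ < 1) {s A : ℝ} (hs : 0 ≤ s) {a b : ℚ → B} (h : GaussBound p s b A)
    (hb : ∀ i, φ (b (i / p)) - α * b i = a i) (i : ℚ) :
    HasSum (fun m : ℕ => coeffTerm p α φ a i m) (-(b i)) := by
  have := hasSum_telescope (tendsto_twistTerm hφ hα hs h i)
  simp only [Nat.cast_zero, twistTerm_zero] at this
  simpa only [coeffTerm_eq_sub hφα hb, Nat.cast_add, Nat.cast_one] using this

theorem hasSum_coeffTerm_int [Fact p.Prime] [IsUltrametricDist B] [CompleteSpace B]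
    (hφ : ∀ x, ‖φ x‖ = ‖x‖) (hφα : φ (α : B) = α)
    (hα : ‖((α⁻¹ : Bˣ) : B)‖ < 1) {s A : ℝ} (hs : 0 < s) {a b : ℚ → B} (h : GaussBound p s b A)
    (hb : ∀ i, φ (b (i / p)) - α * b i = a i) {i : ℚ} (hi : i < 0) :
    HasSum (fun m : ℤ => coeffTerm p α φ a i m) 0 := by
  -- The half `m ≥ 0` sums to `-b_i` and the half `m < 0` to `b_i`.
  rw [← neg_add_cancel (b i)]
  refine HasSum.of_nat_of_neg_add_one (hasSum_coeffTerm_nat hφ hφα hα hs.le h hb i) ?_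
  have := (hasSum_telescope (tendsto_twistTerm_neg (α := α) hφ hs h hi)).neg
  simp only [Nat.cast_zero, neg_zero, twistTerm_zero, neg_neg, neg_sub] at this
  have he : ∀ n : ℕ, coeffTerm p α φ a i (-((n : ℤ) + 1)) =
      twistTerm p α φ b i (-(n : ℤ)) - twistTerm p α φ b i (-((n + 1 : ℕ) : ℤ)) := fun n => by
    rw [coeffTerm_eq_sub hφα hb, neg_add, neg_add_cancel_right, Nat.cast_succ, neg_add]
  simpa only [he] using this

/-! #### Sufficiency -/

theorem summable_coeffTerm [Fact p.Prime] [IsUltrametricDist B] [CompleteSpace B]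
    (hφ : ∀ x, ‖φ x‖ = ‖x‖) (hα : ‖((α⁻¹ : Bˣ) : B)‖ < 1)
    {s A : ℝ} (hs : 0 ≤ s) {a : ℚ → B} (h : GaussBound p s a A) (i : ℚ) :
    Summable fun m : ℕ => coeffTerm p α φ a i m := by
  refine NonarchimedeanAddGroup.summable_of_tendsto_cofinite_zero ?_
  rw [Nat.cofinite_eq_atTop]
  simpa only [coeffTerm_eq_mul, mul_zero] using
    (tendsto_twistTerm hφ hα hs h i).const_mul ((α⁻¹ : Bˣ) : B)

theorem map_coeffTerm_div [Fact p.Prime] (hφα : φ (α : B) = α) (a : ℚ → B) (i : ℚ) (m : ℕ) :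
    φ (coeffTerm p α φ a (i / p) m) = α * coeffTerm p α φ a i ((m + 1 : ℕ) : ℤ) := by
  have hp0 : (p : ℚ) ≠ 0 := by exact_mod_cast (Fact.out : p.Prime).ne_zero
  have h1 : i / p * (p : ℚ) ^ (-(m : ℤ)) = i * (p : ℚ) ^ (-((m + 1 : ℕ) : ℤ)) := by
    push_cast
    rw [neg_add, zpow_add₀ hp0, zpow_neg_one]
    ring_nf
  have h2 : φ (((α ^ (-((m : ℤ) + 1)) : Bˣ) : B)) = ((α ^ (-((m : ℤ) + 1)) : Bˣ) : B) := by
    have h3 : Units.map φ.toRingHom.toMonoidHom α = α := Units.ext hφα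
    conv_rhs => rw [← h3, ← map_zpow]
    rfl
  have h4 : ((α ^ (-((m : ℤ) + 1)) : Bˣ) : B) = α * ((α ^ (-(((m + 1 : ℕ) : ℤ) + 1)) : Bˣ) : B) :=
    by
    rw [← Units.val_mul, ← zpow_one_add]
    congr 2
  rw [coeffTerm, coeffTerm, map_mul, h2, h1, h4, ← RingAut.mul_apply, ← zpow_one_add, mul_assoc]
  congr 4
  exact add_comm _ _

/-- By `map_coeffTerm_div`, the series for `φ(b_{i/p})` is that for `α b_i` without its term `m =
0`, and that term contributes exactly `a_i`. -/
theorem solves_of_hasSum [Fact p.Prime] (hφ : ∀ x, ‖φ x‖ = ‖x‖) (hφα : φ (α : B) = α) {a b : ℚ → B}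
    (hb : ∀ i, HasSum (fun m : ℕ => coeffTerm p α φ a i m) (-(b i))) (i : ℚ) :
    φ (b (i / p)) - α * b i = a i := by
  have hc : Continuous φ := AddMonoidHomClass.continuous_of_bound φ 1 (by simp [hφ])
  have h1 := (hb (i / p)).map φ hc
  have h2 := ((hasSum_nat_add_iff' 1).2 (hb i)).mul_left (α : B)
  have h3 : φ ∘ (fun m : ℕ => coeffTerm p α φ a (i / p) m) =
      fun m : ℕ => α * coeffTerm p α φ a i ((m + 1 : ℕ) : ℤ) :=
    funext fun m => map_coeffTerm_div hφα a i m
  have h4 : (α : B) * coeffTerm p α φ a i ((0 : ℕ) : ℤ) = a i := by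
    simp [coeffTerm]
  rw [h3] at h1
  have h5 := h1.unique h2
  rw [Finset.sum_range_one, mul_sub, h4, map_neg] at h5
  linear_combination -h5

/-- The exchange of series: for `i ≤ -1` the vanishing of the full sum makes the part over `m < 0`
equal to `b_i`. -/
theorem hasSum_stepTerm [IsUltrametricDist B] [CompleteSpace B] {a b : ℚ → B}
    (hb : ∀ i, HasSum (fun m : ℕ => coeffTerm p α φ a i m) (-(b i)))
    (h0 : ∀ i < 0, HasSum (fun m : ℤ => coeffTerm p α φ a i m) 0) (i : ℚ) :
    HasSum (fun m : ℕ => stepTerm p α φ m a i) (b i) := by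
  rcases lt_or_ge (-1) i with hi | hi
  · simp only [stepTerm_apply_of_lt _ _ hi]
    simpa using (hb i).neg
  · simp only [stepTerm_apply_of_le _ _ hi]
    have h1 := h0 i (by linarith)
    have hs : Summable fun m : ℕ => coeffTerm p α φ a i (-((m : ℤ) + 1)) :=
      h1.summable.comp_injective (i := fun m : ℕ => -((m : ℤ) + 1)) fun m n h => by simpa using h
    have h2 := h1.unique (HasSum.of_nat_of_neg_add_one (hb i) hs.hasSum)
    rw [neg_add_eq_zero.1 h2.symm]
    exact hs.hasSum

/-! ### Convergence of the modified series in the Gauss norms. -/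

variable {a b : ℚ → B}

theorem GaussBound.of_hasSum_stepTerm [Fact p.Prime] [IsUltrametricDist B]
    (hab : ∀ i, HasSum (fun m : ℕ => RelRobba.stepTerm p α φ m a i) (b i))
    (hφ : ∀ x, ‖φ x‖ = ‖x‖) {s A K : ℝ} (hs : 0 ≤ s)
    (hK : ∀ m, growth p α s m ≤ K) (h : GaussBound p s a A) : GaussBound p s b (K * A) :=
  GaussBound.hasSum (Fact.out : p.Prime).one_lt
    (mul_nonneg ((growth_nonneg α s 0).trans (hK 0)) h.nonneg)
    (fun m => (h.stepTerm hφ m hs).mono (mul_le_mul_of_nonneg_right (hK m) h.nonneg)) hab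

theorem GaussBound.sub_sum_stepTerm [Fact p.Prime] [IsUltrametricDist B]
    (hab : ∀ i, HasSum (fun m : ℕ => RelRobba.stepTerm p α φ m a i) (b i))
    (hφ : ∀ x, ‖φ x‖ = ‖x‖) {s A e : ℝ} (hs : 0 ≤ s) {N : ℕ}
    (hN : ∀ m ≥ N, growth p α s m ≤ e) (h : GaussBound p s a A) :
    GaussBound p s (b - ∑ m ∈ Finset.range N, RelRobba.stepTerm p α φ m a) (e * A) := by
  refine GaussBound.hasSum (Fact.out : p.Prime).one_lt
    (mul_nonneg ((growth_nonneg α s N).trans (hN N le_rfl)) h.nonneg)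
    (f := fun m => RelRobba.stepTerm p α φ (m + N) a)
    (fun m => (h.stepTerm hφ _ hs).mono
      (mul_le_mul_of_nonneg_right (hN _ (Nat.le_add_left N m)) h.nonneg)) fun i => ?_
  rw [Pi.sub_apply, Finset.sum_apply]
  exact (hasSum_nat_add_iff' N).2 (hab i)

theorem eventually_gaussBound_sub_sum [Fact p.Prime] [IsUltrametricDist B]
    (hab : ∀ i, HasSum (fun m : ℕ => RelRobba.stepTerm p α φ m a i) (b i))
    (hφ : ∀ x, ‖φ x‖ = ‖x‖) (hα : ‖((α⁻¹ : Bˣ) : B)‖ < 1) {s A : ℝ}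
    (hs : 0 < s) (h : GaussBound p s a A) {ε : ℝ} (hε : 0 < ε) :
    ∀ᶠ N in atTop, GaussBound p s (b - ∑ m ∈ Finset.range N, stepTerm p α φ m a) ε := by
  -- `A` may be zero, so it is enlarged before dividing by it.
  have hA : 0 < A + 1 := by linarith [h.nonneg]
  have h1 : ∀ᶠ m in atTop, growth p α s m < ε / (A + 1) :=
    (tendsto_growth (Fact.out : p.Prime).one_lt hα hs).eventually_lt_const (by positivity)
  obtain ⟨N, hN⟩ := eventually_atTop.1 h1
  filter_upwards [eventually_ge_atTop N] with M hM
  refine (GaussBound.sub_sum_stepTerm hab hφ hs.le (fun m hm => (hN m (hM.trans hm)).le)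
    (h.mono (by linarith : A ≤ A + 1))).mono ?_
  rw [div_mul_cancel₀ _ hA.ne']

theorem IsExtRobba.of_hasSum_stepTerm [Fact p.Prime] [IsUltrametricDist B] [NormedAlgebra ℚ_[p] B]
    (hab : ∀ i, HasSum (fun m : ℕ => RelRobba.stepTerm p α φ m a i) (b i))
    (hφ : ∀ x, ‖φ x‖ = ‖x‖)
    (hα : ‖((α⁻¹ : Bˣ) : B)‖ < 1) {r : ℝ} (hr : 0 < r) (h : IsExtRobba p (Set.Ioc 0 r) a) :
    IsExtRobba p (Set.Ioc 0 r) b := by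
  have hp := (Fact.out : p.Prime).one_lt
  refine IsExtRobba.of_approx hp hr fun s hs ε hε => ?_
  obtain ⟨A, hA⟩ := h.gaussBound hp hs
  obtain ⟨N, hN⟩ := (eventually_gaussBound_sub_sum hab hφ hα hs.1 hA hε).exists
  exact ⟨_, (extRobbaLE p B r).sum_mem fun m _ => h.stepTerm hφ m, hN⟩

/-- Since `φ` is isometric, `b_i` has the norm of the coefficient of `a + α b` at `i p`. Hence the
radius `s` for `b` corresponds to `s / p` for `a + α b`, and `s` may go up to `p r`. -/
theorem IsExtRobba.of_solves [Fact p.Prime] [IsUltrametricDist B] [NormedAlgebra ℚ_[p] B]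
    (hφ : ∀ x, ‖φ x‖ = ‖x‖)
    (hsol : ∀ i, φ (b (i / p)) - α * b i = a i) {r : ℝ} (ha : IsExtRobba p (Set.Ioc 0 r) a)
    (hb : IsExtRobba p (Set.Ioc 0 r) b) : IsExtRobba p (Set.Ioc 0 (p * r)) b := by
  have hp := (Fact.out : p.Prime).one_lt
  have hp0 : (0 : ℝ) < p := by exact_mod_cast hp.pos
  have hp0' : (0 : ℚ) < p := by exact_mod_cast hp.pos
  have hc : IsExtRobba p (Set.Ioc 0 r) (a + (α : B) • b) :=
    (extRobbaLE p B r).add_mem ha (hb.smul _)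
  have h1 : ∀ i, ‖b i‖ = ‖(a + (α : B) • b) (i * p)‖ := fun i => by
    have := hsol (i * p)
    rw [mul_div_cancel_right₀ _ hp0'.ne'] at this
    rw [← hφ, Pi.add_apply, Pi.smul_apply, smul_eq_mul, ← this, sub_add_cancel]
  refine hc.of_le_comp hp hp0' zero_le_one (fun i => by rw [h1, one_mul]) fun s hs =>
    ⟨s / p, ⟨div_pos hs.1 hp0, (div_le_iff₀' hp0).2 hs.2⟩, 1, zero_le_one, fun i => ?_⟩
  rw [h1, one_mul]
  push_cast
  rw [show s / p * ((i : ℝ) * p) = s * i by field_simp]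

end Equation

end RelRobba

namespace RelRobba

/-! ### Projective tensor seminorms of linear maps -/

section ProjMap

variable {R M N M' N' : Type*} [CommRing R] [AddCommGroup M] [Module R M] [AddCommGroup N] [Module
  R N]
  [AddCommGroup M'] [Module R M'] [AddCommGroup N'] [Module R N']
  {q : M → ℝ} {q' : N → ℝ} {q₁ : M' → ℝ} {q₁' : N' → ℝ}

theorem projNorm_map_le (U : M →ₗ[R] M') (A : N →ₗ[R] N') {K : ℝ} (hK : 0 ≤ K)
    (h : ∀ m n, q₁ (U m) * q₁' (A n) ≤ K * (q m * q' n)) (x : M ⊗[R] N) :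
    projNorm q₁ q₁' (TensorProduct.map U A x) ≤ K * projNorm q q' x := by
  have hε : ∀ ε > 0, projNorm q₁ q₁' (TensorProduct.map U A x) ≤ K * (projNorm q q' x + ε) := by
    intro ε hε
    obtain ⟨h0, l, hl, hb⟩ := ProjBound.of_lt (lt_add_of_pos_right (projNorm q q' x) hε)
    refine projNorm_le ⟨by positivity, l.map fun z => (U z.1, A z.2), ?_, ?_⟩
    · conv_rhs => rw [← hl]
      rw [map_list_sum, List.map_map, List.map_map]
      simp [Function.comp_def]
    · intro z hz
      obtain ⟨w, hw, rfl⟩ := List.mem_map.1 hz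
      exact (h _ _).trans (mul_le_mul_of_nonneg_left (hb w hw) hK)
  refine ge_of_tendsto (f := fun ε => K * (projNorm q q' x + ε)) (x := 𝓝[>] (0 : ℝ)) ?_
    (eventually_mem_nhdsWithin.mono hε)
  have : Continuous fun ε : ℝ => K * (projNorm q q' x + ε) := by fun_prop
  simpa using (this.tendsto 0).mono_left nhdsWithin_le_nhds

theorem projNorm_sum_le {x : ℕ → M ⊗[R] N} {C : ℝ} (hC : 0 ≤ C) (u : Finset ℕ)
    (h : ∀ n ∈ u, projNorm q q' (x n) ≤ C) : projNorm q q' (∑ n ∈ u, x n) ≤ C := by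
  induction u using Finset.cons_induction with
  | empty => simpa [projNorm_zero] using hC
  | cons n u hn ih =>
    rw [Finset.sum_cons]
    exact (projNorm_add_le _ _).trans
      (max_le (h n (by simp)) (ih fun m hm => h m (by simp [hm])))

/-- The sign is moved to the second tensor factor, whose norm is symmetric; `q` is an arbitrary
function. -/
theorem projNorm_neg_le {N : Type*} [SeminormedAddCommGroup N] [Module R N] (x : M ⊗[R] N) :
    projNorm q (norm : N → ℝ) (-x) ≤ projNorm q norm x := by
  have h := projNorm_map_le (q := q) (q₁ := q) (q' := (norm : N → ℝ)) (q₁' := norm)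
    (LinearMap.id : M →ₗ[R] M) (-(LinearMap.id : N →ₗ[R] N)) zero_le_one (by simp) x
  change projNorm q norm (LinearMap.lTensor M (-LinearMap.id) x) ≤ _ at h
  rwa [LinearMap.lTensor_neg, LinearMap.lTensor_id, LinearMap.neg_apply, LinearMap.id_apply,
    one_mul] at h

end ProjMap

/-! ### The Frobenius of `S_L` -/

section Frob

variable {p : ℕ} [Fact p.Prime] {L S : Type*} [NormedField L] [NormedAlgebra ℚ_[p] L]
  [NormedCommRing S] [NormedAlgebra ℚ_[p] S]

theorem norm_tensorMap (σ : L ≃ₐ[ℚ_[p]] L) (hσ : ∀ x, ‖σ x‖ = ‖x‖) (x : ProjTensor p L S) :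
    ‖tensorMap S σ x‖ = ‖x‖ := by
  refine le_antisymm (norm_tensorMap_le σ hσ x) ?_
  have hσ' : ∀ x, ‖σ.symm x‖ = ‖x‖ := fun x => by simpa using (hσ (σ.symm x)).symm
  have h : tensorMap S σ.symm (tensorMap S σ x) = x :=
    congrArg (fun f : ProjTensor p L S →+* ProjTensor p L S => f x) (tensorMap_comp_symm S σ.symm)
  calc ‖x‖ = ‖tensorMap S σ.symm (tensorMap S σ x)‖ := by rw [h]
    _ ≤ _ := norm_tensorMap_le σ.symm hσ' _

theorem frob_coe (σ : L ≃ₐ[ℚ_[p]] L) (hσ : ∀ x, ‖σ x‖ = ‖x‖) (x : ProjTensor p L S) :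
    frob S σ hσ (x : CTensor p L S) = (tensorMap S σ x : ProjTensor p L S) :=
  UniformSpace.Completion.mapRingHom_coe (f := tensorMap S σ) (continuous_tensorMap S σ hσ) _

theorem continuous_frob (σ : L ≃ₐ[ℚ_[p]] L) (hσ : ∀ x, ‖σ x‖ = ‖x‖) : Continuous (frob S σ hσ) :=
  UniformSpace.Completion.continuous_map

theorem norm_frob (σ : L ≃ₐ[ℚ_[p]] L) (hσ : ∀ x, ‖σ x‖ = ‖x‖) (x : CTensor p L S) :
    ‖frob S σ hσ x‖ = ‖x‖ := by
  induction x using UniformSpace.Completion.induction_on with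
  | hp => exact isClosed_eq (continuous_frob σ hσ).norm continuous_norm
  | ih x =>
    rw [frob_coe, UniformSpace.Completion.norm_coe, UniformSpace.Completion.norm_coe,
      norm_tensorMap σ hσ]

/-- The image of `l ⊗ s` in `S_L`. -/
noncomputable def ctmul (l : L) (s : S) : CTensor p L S :=
  ((ProjTensor.of p L S (l ⊗ₜ s) : ProjTensor p L S) : CTensor p L S)

theorem frob_ctmul (σ : L ≃ₐ[ℚ_[p]] L) (hσ : ∀ x, ‖σ x‖ = ‖x‖) (l : L) (s : S) :
    frob S σ hσ (ctmul l s) = ctmul (p := p) (σ l) s := frob_tmul S σ hσ l s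

theorem frob_zpow_ctmul (σ : L ≃ₐ[ℚ_[p]] L) (hσ : ∀ x, ‖σ x‖ = ‖x‖) (m : ℤ) (l : L) (s : S) :
    (frob S σ hσ ^ m) (ctmul l s) = ctmul (p := p) ((σ ^ m) l) s := by
  have hinv : ∀ l, (frob S σ hσ)⁻¹ (ctmul l s) = ctmul (p := p) (σ⁻¹ l) s := fun l => by
    refine (frob S σ hσ).injective ?_
    rw [← RingAut.mul_apply, mul_inv_cancel, RingAut.one_apply, frob_ctmul, ← AlgEquiv.mul_apply,
      mul_inv_cancel, AlgEquiv.one_apply]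
  induction m generalizing l with
  | zero => simp
  | succ n ih => rw [zpow_add_one, RingAut.mul_apply, frob_ctmul, ih, zpow_add_one,
    AlgEquiv.mul_apply]
  | pred n ih => rw [zpow_sub_one, RingAut.mul_apply, hinv, ih, zpow_sub_one, AlgEquiv.mul_apply]

theorem norm_algEquiv_zpow {σ : L ≃ₐ[ℚ_[p]] L} (hσ : ∀ x, ‖σ x‖ = ‖x‖) (m : ℤ) (x : L) :
    ‖(σ ^ m) x‖ = ‖x‖ := by
  have hinv : ∀ x, ‖σ⁻¹ x‖ = ‖x‖ := fun x => by
    rw [← hσ, ← AlgEquiv.mul_apply, mul_inv_cancel, AlgEquiv.one_apply]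
  induction m generalizing x with
  | zero => simp
  | succ n ih => rw [zpow_add_one, AlgEquiv.mul_apply, ih, hσ]
  | pred n ih => rw [zpow_sub_one, AlgEquiv.mul_apply, ih, hinv]

theorem inclS_eq_ctmul (s : S) : inclS p L S s = ctmul 1 s := rfl

theorem ctmul_mul_ctmul (l l' : L) (s s' : S) :
    (ctmul l s * ctmul l' s' : CTensor p L S) = ctmul (l * l') (s * s') := by
  rw [ctmul, ctmul, ← UniformSpace.Completion.coe_mul, ← map_mul,
    Algebra.TensorProduct.tmul_mul_tmul]
  rfl

theorem norm_inclS_le (s : S) : ‖inclS p L S s‖ ≤ ‖s‖ := by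
  rw [inclS_eq_ctmul, ctmul, UniformSpace.Completion.norm_coe]
  exact projNorm_le (ProjBound.tmul _ _ (norm_nonneg s) (by simp))

theorem frob_inclS (σ : L ≃ₐ[ℚ_[p]] L) (hσ : ∀ x, ‖σ x‖ = ‖x‖) (s : S) :
    frob S σ hσ (inclS p L S s) = inclS p L S s := by
  rw [inclS_eq_ctmul, frob_ctmul, map_one]

end Frob

/-! ### The terms of the solution on `R̃^r_L ⊗ S` -/

section Additive

variable {B : Type*} [NormedCommRing B] {p : ℕ} {α : Bˣ} {φ : B ≃+* B}

theorem stepTerm_add (m : ℕ) (a a' : ℚ → B) :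
    stepTerm p α φ m (a + a') = stepTerm p α φ m a + stepTerm p α φ m a' := by
  ext i
  rcases lt_or_ge (-1) i with hi | hi
  · simp only [Pi.add_apply, stepTerm_apply_of_lt _ _ hi, coeffTerm, map_add]
    ring
  · simp only [Pi.add_apply, stepTerm_apply_of_le _ _ hi, coeffTerm, map_add]
    ring

theorem stepTerm_sub (m : ℕ) (a a' : ℚ → B) :
    stepTerm p α φ m (a - a') = stepTerm p α φ m a - stepTerm p α φ m a' := by
  rw [eq_sub_iff_add_eq, ← stepTerm_add, sub_add_cancel]

end Additive

section Tensor

variable {p : ℕ} [Fact p.Prime] {L S : Type*} [NormedField L] [NormedAlgebra ℚ_[p] L]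
  [IsUltrametricDist L] [NormedCommRing S] [NormedAlgebra ℚ_[p] S] {r : ℝ}

/-- `twist` as a linear endomorphism of `R̃^r_L`. -/
noncomputable def twistLinear {σ : L ≃ₐ[ℚ_[p]] L} (hσ : ∀ x, ‖σ x‖ = ‖x‖) {c : ℚ} (hc : 0 < c)
    {P : Set ℚ} {κ : ℝ} (hκ : ∀ i ∈ P, ((c : ℝ) - 1) * (i : ℝ) ≤ κ) :
    extRobbaLE p L r →ₗ[ℚ_[p]] extRobbaLE p L r where
  toFun f := ⟨twist σ c P f, IsExtRobba.twist (Fact.out : p.Prime).one_lt hσ hc hκ f.2⟩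
  map_add' f g := by
    ext i
    by_cases hi : i ∈ P <;> simp [twist, hi]
  map_smul' k f := by
    ext i
    by_cases hi : i ∈ P <;> simp [twist, hi]

/-- A real supremum is an upper bound only for a bounded family; membership in `R̃^r_L` supplies the
boundedness. -/
theorem gaussBound_gaussNorm {s : ℝ} (hs : s ∈ Set.Ioc 0 r) (f : extRobbaLE p L r) :
    GaussBound p s (f : ℚ → L) (gaussNorm p s (f : ℚ → L)) := by
  obtain ⟨A, hA⟩ := IsExtRobba.gaussBound (Fact.out : p.Prime).one_lt f.2 hs
  exact le_ciSup ⟨A, by rintro _ ⟨i, rfl⟩; exact hA i⟩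

theorem gaussNorm_twistLinear_le {σ : L ≃ₐ[ℚ_[p]] L} (hσ : ∀ x, ‖σ x‖ = ‖x‖) {c : ℚ} (hc : 0 < c)
    {P : Set ℚ} {κ : ℝ} (hκ : ∀ i ∈ P, ((c : ℝ) - 1) * (i : ℝ) ≤ κ) {s : ℝ} (hs : s ∈ Set.Ioc 0 r)
    (f : extRobbaLE p L r) :
    gaussNorm p s (twistLinear hσ hc hκ f : ℚ → L) ≤ (p : ℝ) ^ (s * κ) * gaussNorm p s (f : ℚ → L)
      :=
  ciSup_le ((gaussBound_gaussNorm hs f).twist (Fact.out : p.Prime).one_lt hσ hs.1.le hκ)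

/-- The norm `max(|·|_s, |·|_r)` on `R̃^r_L`. -/
noncomputable def maxNorm (s : ℝ) (f : extRobbaLE p L r) : ℝ :=
  max (gaussNorm p s (f : ℚ → L)) (gaussNorm p r (f : ℚ → L))

theorem projNorm_map_twistLinear_le {σ : L ≃ₐ[ℚ_[p]] L} (hσ : ∀ x, ‖σ x‖ = ‖x‖) {c : ℚ} (hc : 0 < c)
    {P : Set ℚ} {κ : ℝ} (hκ : ∀ i ∈ P, ((c : ℝ) - 1) * (i : ℝ) ≤ κ) {s : ℝ} (hs : s ∈ Set.Ioc 0 r)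
    (γ : S) {K : ℝ} (hK : (p : ℝ) ^ (s * κ) * ‖γ‖ ≤ K) (hK' : (p : ℝ) ^ (r * κ) * ‖γ‖ ≤ K)
    (x : (extRobbaLE p L r) ⊗[ℚ_[p]] S) :
    projNorm (maxNorm s) norm (TensorProduct.map (twistLinear hσ hc hκ) (LinearMap.mulLeft ℚ_[p] γ)
      x)
      ≤ K * projNorm (maxNorm s) norm x := by
  have hK0 : 0 ≤ K := le_trans (by positivity) hK
  refine projNorm_map_le _ _ hK0 (fun f y => ?_) x
  have hr : r ∈ Set.Ioc 0 r := ⟨hs.1.trans_le hs.2, le_rfl⟩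
  have h0 := (gaussBound_gaussNorm hs f).nonneg
  have h0' := (gaussBound_gaussNorm hr f).nonneg
  have h1 : ‖LinearMap.mulLeft ℚ_[p] γ y‖ ≤ ‖γ‖ * ‖y‖ := norm_mul_le γ y
  have h2 : maxNorm s (twistLinear hσ hc hκ f) * ‖γ‖ ≤ K * maxNorm s f := by
    rw [maxNorm, max_mul_of_nonneg _ _ (norm_nonneg γ)]
    refine max_le ?_ ?_
    · calc _ ≤ (p : ℝ) ^ (s * κ) * gaussNorm p s (f : ℚ → L) * ‖γ‖ := by
            gcongr; exact gaussNorm_twistLinear_le hσ hc hκ hs f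
        _ = (p : ℝ) ^ (s * κ) * ‖γ‖ * gaussNorm p s (f : ℚ → L) := by ring
        _ ≤ _ := mul_le_mul hK (le_max_left _ _) h0 hK0
    · calc _ ≤ (p : ℝ) ^ (r * κ) * gaussNorm p r (f : ℚ → L) * ‖γ‖ := by
            gcongr; exact gaussNorm_twistLinear_le hσ hc hκ hr f
        _ = (p : ℝ) ^ (r * κ) * ‖γ‖ * gaussNorm p r (f : ℚ → L) := by ring
        _ ≤ _ := mul_le_mul hK' (le_max_right _ _) h0' hK0
  have h3 : 0 ≤ maxNorm s (twistLinear hσ hc hκ f) :=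
    le_max_of_le_left (gaussBound_gaussNorm hs _).nonneg
  calc _ ≤ maxNorm s (twistLinear hσ hc hκ f) * (‖γ‖ * ‖y‖) := by gcongr
    _ = maxNorm s (twistLinear hσ hc hκ f) * ‖γ‖ * ‖y‖ := by ring
    _ ≤ K * maxNorm s f * ‖y‖ := by gcongr
    _ = _ := by ring

theorem toSeries_map_twistLinear {σ : L ≃ₐ[ℚ_[p]] L} (hσ : ∀ x, ‖σ x‖ = ‖x‖) {c : ℚ} (hc : 0 < c)
    {P : Set ℚ} {κ : ℝ} (hκ : ∀ i ∈ P, ((c : ℝ) - 1) * (i : ℝ) ≤ κ) (γ : S)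
    (ψ : CTensor p L S ≃+* CTensor p L S) (hψ : ∀ l s, ψ (ctmul l s) = ctmul (σ l) s)
    (x : (extRobbaLE p L r) ⊗[ℚ_[p]] S) :
    toSeries p L S r (TensorProduct.map (twistLinear hσ hc hκ) (LinearMap.mulLeft ℚ_[p] γ) x) =
      inclS p L S γ • twist ψ c P (toSeries p L S r x) := by
  induction x using TensorProduct.induction_on with
  | zero =>
    ext i
    simp [twist]
  | tmul f s =>
    ext i
    rw [TensorProduct.map_tmul, toSeries_tmul, Pi.smul_apply, smul_eq_mul]
    change ctmul (twist σ c P (f : ℚ → L) i) (γ * s) = _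
    by_cases hi : i ∈ P
    · rw [twist, twist, Set.indicator_of_mem hi, Set.indicator_of_mem hi, toSeries_tmul]
      change _ = _ * ψ (ctmul _ _)
      rw [hψ, inclS_eq_ctmul, ctmul_mul_ctmul, one_mul]
    · rw [twist, twist, Set.indicator_of_notMem hi, Set.indicator_of_notMem hi, mul_zero]
      rw [ctmul, TensorProduct.zero_tmul, map_zero, UniformSpace.Completion.coe_zero]
  | add x y hx hy =>
    rw [map_add, map_add, hx, hy, map_add, ← smul_add]
    congr 1
    ext i
    by_cases hi : i ∈ P <;> simp [twist, hi]

/-- The operator on `R̃^r_L ⊗ S` that induces `stepTerm` on formal sums. -/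
noncomputable def stepLinear (r : ℝ) (α : Sˣ) {σ : L ≃ₐ[ℚ_[p]] L} (hσ : ∀ x, ‖σ x‖ = ‖x‖) (m : ℕ) :
    (extRobbaLE p L r) ⊗[ℚ_[p]] S →ₗ[ℚ_[p]] (extRobbaLE p L r) ⊗[ℚ_[p]] S :=
  have hp0 : (0 : ℚ) < p := by exact_mod_cast (Fact.out : p.Prime).pos
  TensorProduct.map (twistLinear (norm_algEquiv_zpow hσ (m : ℤ)) (zpow_pos hp0 (-(m : ℤ)))
      (pow_sub_one_mul_le_one (Fact.out : p.Prime).one_lt m))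
    (LinearMap.mulLeft ℚ_[p] (-((α⁻¹ : Sˣ) : S) ^ (m + 1))) +
  TensorProduct.map (twistLinear (norm_algEquiv_zpow hσ (-((m : ℤ) + 1))) (zpow_pos hp0 ((m : ℤ) +
    1))
      (pow_sub_one_mul_le (Fact.out : p.Prime).one_lt m))
    (LinearMap.mulLeft ℚ_[p] ((α : S) ^ m))

theorem projNorm_stepLinear_le (α : Sˣ) {σ : L ≃ₐ[ℚ_[p]] L} (hσ : ∀ x, ‖σ x‖ = ‖x‖) (m : ℕ) {s : ℝ}
    (hs : s ∈ Set.Ioc 0 r) {K : ℝ} (hK : growth p α s m ≤ K) (hK' : growth p α r m ≤ K)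
    (x : (extRobbaLE p L r) ⊗[ℚ_[p]] S) :
    projNorm (maxNorm s) norm (stepLinear r α hσ m x) ≤ K * projNorm (maxNorm s) norm x := by
  rw [growth, max_le_iff] at hK hK'
  refine (projNorm_add_le _ _).trans (max_le ?_ ?_)
  · exact projNorm_map_twistLinear_le _ _ _ hs _ (by simpa using hK.1) (by simpa using hK'.1) x
  · exact projNorm_map_twistLinear_le _ _ _ hs _ hK.2 hK'.2 x

theorem toSeries_stepLinear (α : Sˣ) {σ : L ≃ₐ[ℚ_[p]] L} (hσ : ∀ x, ‖σ x‖ = ‖x‖) (m : ℕ)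
    (x : (extRobbaLE p L r) ⊗[ℚ_[p]] S) :
    toSeries p L S r (stepLinear r α hσ m x) =
      stepTerm p (Units.map (inclS p L S).toMonoidHom α) (frob S σ hσ) m (toSeries p L S r x) := by
  rw [stepLinear, LinearMap.add_apply, map_add,
    toSeries_map_twistLinear _ _ _ _ (frob S σ hσ ^ (m : ℤ)) (frob_zpow_ctmul σ hσ _),
    toSeries_map_twistLinear _ _ _ _ (frob S σ hσ ^ (-((m : ℤ) + 1))) (frob_zpow_ctmul σ hσ _),
    stepTerm, map_neg, map_pow, map_pow, neg_smul]
  rfl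

/-! ### The completed tensor product -/

/-- By the ultrametric inequality, small consecutive differences suffice. -/
theorem isProjCauchy_of_succ {y : ℕ → (extRobbaLE p L r) ⊗[ℚ_[p]] S}
    (h : ∀ s ∈ Set.Ioc 0 r, ∀ ε : ℝ, 0 < ε → ∃ N : ℕ, ∀ n ≥ N,
      projNorm (maxNorm s) norm (y (n + 1) - y n) < ε) : IsProjCauchy r y := by
  intro s hs ε hε
  obtain ⟨N, hN⟩ := h s hs ε hε
  have h1 : ∀ n ≥ N, projNorm (maxNorm s) norm (y n - y N) < ε := by
    intro n hn
    induction n, hn using Nat.le_induction with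
    | base => rwa [sub_self, projNorm_zero]
    | succ n hn ih =>
      rw [← sub_add_sub_cancel (y (n + 1)) (y n)]
      exact (projNorm_add_le _ _).trans_lt (max_lt (hN n hn) ih)
  refine ⟨N, fun m hm n hn => ?_⟩
  rw [← sub_add_sub_cancel (y m) (y N)]
  refine (projNorm_add_le _ _).trans_lt (max_lt (h1 m hm) ?_)
  rw [← neg_sub (y n)]
  exact (projNorm_neg_le _).trans_lt (h1 n hn)

theorem IsProjCauchy.bounded {x : ℕ → (extRobbaLE p L r) ⊗[ℚ_[p]] S} (hx : IsProjCauchy r x) {s : ℝ}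
    (hs : s ∈ Set.Ioc 0 r) :
    ∃ N : ℕ, ∃ X : ℝ, 0 < X ∧ ∀ n ≥ N, projNorm (maxNorm s) norm (x n) ≤ X := by
  obtain ⟨N, hN⟩ := hx s hs 1 one_pos
  refine ⟨N, max 1 (projNorm (maxNorm s) norm (x N)), by positivity, fun n hn => ?_⟩
  rw [← sub_add_cancel (x n) (x N)]
  exact (projNorm_add_le _ _).trans (max_le_max_right _ (hN n hn N le_rfl).le)

theorem IsProjCauchy.sum_stepLinear {α : Sˣ} (hα : ‖((α⁻¹ : Sˣ) : S)‖ < 1) {σ : L ≃ₐ[ℚ_[p]] L}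
    (hσ : ∀ x, ‖σ x‖ = ‖x‖) {x : ℕ → (extRobbaLE p L r) ⊗[ℚ_[p]] S} (hx : IsProjCauchy r x) :
    IsProjCauchy r fun n => ∑ m ∈ Finset.range n, stepLinear r α hσ m (x n) := by
  have hp := (Fact.out : p.Prime).one_lt
  refine isProjCauchy_of_succ fun s hs ε hε => ?_
  have hr : 0 < r := hs.1.trans_le hs.2
  obtain ⟨K, hK, hsK⟩ := exists_growth_le hp hα hs.1
  obtain ⟨K', hK', hrK⟩ := exists_growth_le hp hα hr
  obtain ⟨N₁, X, hX, hxX⟩ := hx.bounded hs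
  obtain ⟨N₂, hN₂⟩ := hx s hs (ε / 2 / max K K') (by positivity)
  obtain ⟨N₃, hN₃⟩ := eventually_atTop.1
    ((tendsto_growth hp hα hs.1).eventually_lt_const (show 0 < ε / 2 / X by positivity))
  obtain ⟨N₄, hN₄⟩ := eventually_atTop.1
    ((tendsto_growth hp hα hr).eventually_lt_const (show 0 < ε / 2 / X by positivity))
  refine ⟨max (max N₁ N₂) (max N₃ N₄), fun n hn => ?_⟩
  simp only [ge_iff_le, max_le_iff] at hn
  obtain ⟨⟨hn₁, hn₂⟩, hn₃, hn₄⟩ := hn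
  -- The first summand is small because `x` is Cauchy and `growth` is bounded, the second because `x
  -- n` stays bounded and `growth` tends to `0`. Both factors are controlled at `s` and at `r`, as
  -- the norm is a maximum over these two radii.
  have h1 : ∑ m ∈ Finset.range (n + 1), stepLinear r α hσ m (x (n + 1)) -
      ∑ m ∈ Finset.range n, stepLinear r α hσ m (x n) =
      ∑ m ∈ Finset.range (n + 1), stepLinear r α hσ m (x (n + 1) - x n) +
        stepLinear r α hσ n (x n) := by
    simp only [map_sub, Finset.sum_sub_distrib, Finset.sum_range_succ]
    abel
  rw [h1]
  refine (projNorm_add_le _ _).trans_lt ((max_le ?_ ?_).trans_lt (half_lt_self hε))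
  · refine projNorm_sum_le (by positivity) _ fun m _ => ?_
    refine (projNorm_stepLinear_le α hσ m hs ((hsK m).trans (le_max_left _ _))
      ((hrK m).trans (le_max_right _ _)) _).trans ?_
    calc _ ≤ max K K' * (ε / 2 / max K K') :=
          mul_le_mul_of_nonneg_left (hN₂ _ (by lia) _ hn₂).le (by positivity)
      _ = ε / 2 := by field_simp
  · refine (projNorm_stepLinear_le α hσ n hs (hN₃ n hn₃).le (hN₄ n hn₄).le _).trans ?_
    calc _ ≤ ε / 2 / X * X := mul_le_mul_of_nonneg_left (hxX n hn₁) (by positivity)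
      _ = ε / 2 := by field_simp

theorem mem_completedRobba_of_hasSum {α : Sˣ} (hα : ‖((α⁻¹ : Sˣ) : S)‖ < 1) {σ : L ≃ₐ[ℚ_[p]] L}
    (hσ : ∀ x, ‖σ x‖ = ‖x‖) {a b : ℚ → CTensor p L S}
    (hab : ∀ i, HasSum (fun m : ℕ => stepTerm p (Units.map (inclS p L S).toMonoidHom α)
      (frob S σ hσ) m a i) (b i))
    (ha : a ∈ completedRobba p L S r) (hb : b ∈ extRobbaLE p (CTensor p L S) r) :
    b ∈ completedRobba p L S r := by
  have hp := (Fact.out : p.Prime).one_lt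
  obtain ⟨haR, x, hx, hxa⟩ := ha
  refine ⟨hb, _, hx.sum_stepLinear hα hσ, fun s hs => (tendsto_w_iff hp).2 fun ε hε => ?_⟩
  have hαL : ‖(((Units.map (inclS p L S).toMonoidHom α)⁻¹ : (CTensor p L S)ˣ) : CTensor p L S)‖ < 1
    :=
    (norm_inclS_le _).trans_lt hα
  obtain ⟨K, hK, hsK⟩ := exists_growth_le hp hαL hs.1
  obtain ⟨A, hA⟩ := IsExtRobba.gaussBound hp haR hs
  filter_upwards [(tendsto_w_iff hp).1 (hxa s hs) (ε / K) (by positivity),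
    eventually_gaussBound_sub_sum hab (norm_frob σ hσ) hαL hs.1 hA hε] with n hn hn'
  -- The error splits into the partial sum applied to `x n - a`, controlled by bounded growth, and
  -- the tail of the series for `b`.
  have h1 : toSeries p L S r (∑ m ∈ Finset.range n, stepLinear r α hσ m (x n)) - b =
      ∑ m ∈ Finset.range n, stepTerm p (Units.map (inclS p L S).toMonoidHom α) (frob S σ hσ) m
        (toSeries p L S r (x n) - a) +
      -(b - ∑ m ∈ Finset.range n, stepTerm p (Units.map (inclS p L S).toMonoidHom α)
        (frob S σ hσ) m a) := by
    simp only [map_sum, toSeries_stepLinear, stepTerm_sub, Finset.sum_sub_distrib]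
    abel
  rw [h1]
  refine (GaussBound.sum hε.le _ fun m _ => ?_).add hn'.neg
  refine (hn.stepTerm (norm_frob σ hσ) m hs.1.le).mono ?_
  calc _ ≤ K * (ε / K) := mul_le_mul_of_nonneg_right (hsK m) (by positivity)
    _ = ε := by field_simp

end Tensor

end RelRobba

/-! ### The main theorem. -/

theorem lemma2p5 (p : ℕ) [Fact p.Prime] (S : Type u) [NormedCommRing S]
    [NormedAlgebra ℚ_[p] S] [CompleteSpace S] [IsUltrametricDist S]
    (α : Sˣ) (hα : ‖((α⁻¹ : Sˣ) : S)‖ < 1) (r : ℝ) (hr : 0 < r) :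
    ∃ C : ℝ, ∀ (L : Type v) [NormedField L] [NormedAlgebra ℚ_[p] L] [CompleteSpace L]
      [IsUltrametricDist L] (φL : L ≃ₐ[ℚ_[p]] L) (hφ : ∀ x, ‖φL x‖ = ‖x‖)
      (a : ℚ → CTensor p L S), a ∈ extRobbaLE p (CTensor p L S) r →
      let αL : (CTensor p L S)ˣ := Units.map (inclS p L S).toMonoidHom α
      let IsSol : (ℚ → CTensor p L S) → Prop := fun b =>
        b ∈ extRobbaUnion p (CTensor p L S) ∧
          frobSeries S φL hφ b - (αL : CTensor p L S) • b = a
      let cf : ℚ → ℤ → CTensor p L S := fun i m =>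
        ((αL ^ (-(m + 1)) : (CTensor p L S)ˣ) : CTensor p L S) *
          (frob S φL hφ ^ m) (a (i * (p : ℚ) ^ (-m)))
      (∀ b b', IsSol b → IsSol b' → b = b') ∧
      ((∃ b, IsSol b) ↔ ∀ i : ℚ, i < 0 → HasSum (fun m : ℤ => cf i m) 0) ∧
      (∀ b, IsSol b →
        (∀ i : ℚ, HasSum (fun m : ℕ => cf i (m : ℤ)) (-(b i))) ∧
        b ∈ extRobbaLE p (CTensor p L S) (p * r) ∧
        w p r a - (C : EReal) ≤ w p r b) ∧
      (a ∈ completedRobba p L S r → ∀ b, IsSol b → b ∈ completedRobba p L S r) := by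
  have hp := (Fact.out : p.Prime).one_lt
  -- `K` is chosen in `S`, before `L` and `φ_L` are introduced.
  obtain ⟨K, hK, hαK⟩ := exists_growth_le hp hα hr
  refine ⟨Real.logb p K, ?_⟩
  intro L _ _ _ _ φL hφ a ha αL IsSol cf
  let φ : CTensor p L S ≃+* CTensor p L S := frob S φL hφ
  have hcf : ∀ i m, cf i m = coeffTerm p αL φ a i m := fun _ _ => rfl
  have hφn : ∀ x, ‖φ x‖ = ‖x‖ := norm_frob φL hφ
  have hφα : φ (αL : CTensor p L S) = αL := by
    change frob S φL hφ (inclS p L S (α : S)) = inclS p L S (α : S)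
    exact frob_inclS φL hφ (α : S)
  have hαL : ‖((αL⁻¹ : (CTensor p L S)ˣ) : CTensor p L S)‖ < 1 := (norm_inclS_le _).trans_lt hα
  have hKL : ∀ m, growth p αL r m ≤ K := fun m =>
    (growth_map_le (inclS p L S) norm_inclS_le α r m).trans (hαK m)
  have hsolves : ∀ b, IsSol b → ∀ i, φ (b (i / p)) - αL * b i = a i := fun b hb i =>
    congrFun hb.2 i
  have hbound : ∀ b, IsSol b → ∃ s > 0, ∃ A, GaussBound p s b A := fun b hb => by
    obtain ⟨⟨s, hs⟩, hbs⟩ := Set.mem_iUnion.1 hb.1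
    exact ⟨s, hs, IsExtRobba.gaussBound hp hbs ⟨hs, le_rfl⟩⟩
  have hnat : ∀ b, IsSol b → ∀ i : ℚ, HasSum (fun m : ℕ => cf i (m : ℤ)) (-(b i)) := fun b hb => by
    obtain ⟨s, hs, A, hA⟩ := hbound b hb
    exact hasSum_coeffTerm_nat hφn hφα hαL hs.le hA (hsolves b hb)
  have hint : ∀ b, IsSol b → ∀ i < 0, HasSum (fun m : ℤ => cf i m) 0 := fun b hb i hi => by
    obtain ⟨s, hs, A, hA⟩ := hbound b hb
    exact hasSum_coeffTerm_int hφn hφα hαL hs hA (hsolves b hb) hi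
  have hstep : ∀ b, IsSol b → ∀ i, HasSum (fun m : ℕ => stepTerm p αL φ m a i) (b i) :=
    fun b hb => hasSum_stepTerm (hnat b hb) (hint b hb)
  refine ⟨fun b b' hb hb' => ?_, ⟨fun ⟨b, hb⟩ => hint b hb, fun h => ?_⟩, fun b hb =>
    ⟨hnat b hb, ?_, ?_⟩, fun hac b hb => ?_⟩
  · ext i
    exact neg_injective ((hnat b hb i).unique (hnat b' hb' i))
  · obtain ⟨A, hA⟩ := IsExtRobba.gaussBound hp ha ⟨hr, le_rfl⟩
    have hs : ∀ i, HasSum (fun m : ℕ => coeffTerm p αL φ a i m)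
        (-(-∑' m : ℕ, coeffTerm p αL φ a i m)) := fun i => by
      rw [neg_neg]
      exact (summable_coeffTerm hφn hαL hr.le hA i).hasSum
    -- Radius `r` is enough for existence; the larger radius `p r` holds for every solution.
    refine ⟨fun i => -∑' m : ℕ, coeffTerm p αL φ a i m, Set.mem_iUnion.2 ⟨⟨r, hr⟩, ?_⟩, ?_⟩
    · exact IsExtRobba.of_hasSum_stepTerm (hasSum_stepTerm hs h) hφn hαL hr ha
    · exact funext (solves_of_hasSum hφn hφα hs)
  · exact IsExtRobba.of_solves hφn (hsolves b hb) ha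
      (IsExtRobba.of_hasSum_stepTerm (hstep b hb) hφn hαL hr ha)
  · exact w_sub_le hp hK fun A hA => GaussBound.of_hasSum_stepTerm (hstep b hb) hφn hr.le hKL hA
  · exact mem_completedRobba_of_hasSum hα hφ (hstep b hb) hac
      (IsExtRobba.of_hasSum_stepTerm (hstep b hb) hφn hαL hr ha)
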